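/- Let $\mathbb T=\mathbb R/\mathbb Z$ with the wrap-around distance $|t-t'|_{\mathbb T}=\min_{r\in\mathbb Z}|t-t'+r|$. For $N\in\mathbb N$ and a finite set $\Omega\subset\mathbb T$ of $M<N$ nodes, let $A=A(\Omega,N)=\left(e^{2\pi i k t}\right)_{t\in\Omega,\;k=0,\dots,N-1}\in\mathbb C^{M\times N}$ be the rectangular Vandermonde matrix and $\sigma_{\min}(A)=\min_{\|v\|_2=1}\|A^*v\|_2$ its smallest singular value. A set of nodes is a cluster if it is contained in an arc of $\mathbb T$ of length $1/N$. The set $\Omega$ is a clustered node configuration if $\Omega=\bigcup_{l=1}^L\Lambda_l$ with nonempty clusters $\Lambda_l$ and $$\rho:=N\min_{l\ne l'}\ \min_{t\in\Lambda_l,\,t'\in\Lambda_{l'}}|t-t'|_{\mathbb T}>1\qquad(\rho=\infty\text{ if }L=1).$$ Its normalized minimal separation is $N\min_{t\ne t'\in\Omega}|t-t'|_{\mathbb T}$, and its cluster complexity is $$\mathcal C:=\max_{t\in\Omega}\ \prod_{t'\in\Omega,\;0<|t-t'|_{\mathbb T}\le 1/N}\frac1{N|t-t'|_{\mathbb T}}.$$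 For $\lambda\ge2$ and $\tau>0$ let $\mathcal K(N,\lambda,\tau)$ be the set of all clustered node configurations $\Omega$ with $M<N$ nodes, with normalized minimal separation $\tau$, with largest cluster of cardinality $\lambda$, and with cluster separation $$\rho\ \ge\ 2\lambda\left(2\sqrt2\,\lambda^{\lambda}\,\zeta(2)\,\mathcal C\right)^{1/2},\qquad \zeta(2)=\frac{\pi^2}{6}.$$ Then there are absolute constants $0<c_1\le c_2$ such that for every $\lambda\ge2$ there exist $N_0\in\mathbb N$ and $\tau_0>0$, depending only on $\lambda$, such that for all $N\ge N_0$ and all $0<\tau\le\tau_0$ the minimum of $\sigma_{\min}(A(\Omega,N))$ over $\Omega\in\mathcal K(N,\lambda,\tau)$ exists and $$\sqrt N\,(c_1\tau)^{\lambda-1}\ \le\ \min_{\Omega\in\mathcal K(N,\lambda,\tau)}\sigma_{\min}(A(\Omega,N))\ \le\ \sqrt N\,(c_2\tau)^{\lambda-1}.$$ -/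

import Mathlib

/-! Nodes are points of the circle `UnitAddCircle = ℝ / ℤ`, that is, points of `[0, 1)` with the end
points identified.  Its metric is the wrap-around distance `dist t t' = min_{r ∈ ℤ} |t - t' + r|`, and
`AddCircle.toCircle t = exp (2 π i t)`. -/

/-- The rectangular Vandermonde matrix with entries `z_t ^ k`, `z_t = exp (2 π i t)`, rows indexed by
the nodes `t ∈ Ω` and columns by the exponents `k = 0, …, N - 1`. -/
noncomputable def vandermondeMatrix (N : ℕ) (Ω : Finset UnitAddCircle) : Matrix Ω (Fin N) ℂ :=
  Matrix.of fun t k => (AddCircle.toCircle (t : UnitAddCircle) : ℂ) ^ (k : ℕ)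

/-- The smallest singular value of `A`: the minimum of `‖A* v‖₂` over all `v` with `‖v‖₂ = 1`. -/
noncomputable def sigmaMin {m n : Type*} [Fintype m] [Fintype n] (A : Matrix m n ℂ) : ℝ :=
  sInf {r : ℝ | ∃ v : EuclideanSpace ℂ m, ‖v‖ = 1 ∧
    r = ‖(WithLp.toLp 2 (A.conjTranspose.mulVec v.ofLp) : EuclideanSpace ℂ n)‖}

/-- The infimum in `sigmaMin` is a minimum as soon as there is at least one row. -/
theorem sigmaMin_isLeast {m n : Type*} [Fintype m] [Fintype n] [Nonempty m] (A : Matrix m n ℂ) :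
    IsLeast {r : ℝ | ∃ v : EuclideanSpace ℂ m, ‖v‖ = 1 ∧
      r = ‖(WithLp.toLp 2 (A.conjTranspose.mulVec v.ofLp) : EuclideanSpace ℂ n)‖} (sigmaMin A) := by
  have hcont : Continuous fun v : EuclideanSpace ℂ m =>
      ‖(WithLp.toLp 2 (A.conjTranspose.mulVec v.ofLp) : EuclideanSpace ℂ n)‖ := by
    fun_prop
  have hne : (Metric.sphere (0 : EuclideanSpace ℂ m) 1).Nonempty :=
    NormedSpace.sphere_nonempty.2 zero_le_one
  have hc := (isCompact_sphere (0 : EuclideanSpace ℂ m) 1).image hcont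
  have h := hc.isLeast_sInf (hne.image _)
  have hs : {r : ℝ | ∃ v : EuclideanSpace ℂ m, ‖v‖ = 1 ∧
      r = ‖(WithLp.toLp 2 (A.conjTranspose.mulVec v.ofLp) : EuclideanSpace ℂ n)‖} =
      (fun v : EuclideanSpace ℂ m =>
        ‖(WithLp.toLp 2 (A.conjTranspose.mulVec v.ofLp) : EuclideanSpace ℂ n)‖) ''
        Metric.sphere (0 : EuclideanSpace ℂ m) 1 := by
    ext r
    simp [eq_comm]
  unfold sigmaMin
  rw [hs]
  exact h

/-- A set of nodes is a cluster if it is contained in an arc `[a, a + 1/N]` of the circle. -/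
def IsCluster (N : ℕ) (C : Finset UnitAddCircle) : Prop :=
  ∃ a : ℝ, ∀ t ∈ C, ∃ s : ℝ, a ≤ s ∧ s ≤ a + 1 / N ∧ (s : UnitAddCircle) = t

/-- The normalized minimal cluster separation `ρ = N min_{l ≠ l'} dist (Λ l, Λ l')`; it is `∞` if there
is only one cluster. -/
noncomputable def clusterSeparation (N : ℕ) {L : ℕ} (Λ : Fin L → Finset UnitAddCircle) : ENNReal :=
  ⨅ (l : Fin L) (l' : Fin L) (_ : l ≠ l') (t ∈ Λ l) (t' ∈ Λ l'),
    ENNReal.ofReal (N * dist t t')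

/-- `Ω` is a clustered node configuration with the (nonempty) clusters `Λ 0, …, Λ (L - 1)`. -/
structure IsClusteredConfiguration (N : ℕ) (Ω : Finset UnitAddCircle) {L : ℕ}
    (Λ : Fin L → Finset UnitAddCircle) : Prop where
  nonempty : ∀ l, (Λ l).Nonempty
  iUnion_eq : (⋃ l, (Λ l : Set UnitAddCircle)) = (Ω : Set UnitAddCircle)
  isCluster : ∀ l, IsCluster N (Λ l)
  one_lt_separation : 1 < clusterSeparation N Λ

open Classical in
/-- The cluster complexity
`max_{t ∈ Ω} ∏_{t' ∈ Ω, 0 < dist t t' ≤ 1/N} 1 / (N dist t t')`. -/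
noncomputable def clusterComplexity (N : ℕ) (Ω : Finset UnitAddCircle) : ℝ :=
  ⨆ t : Ω, ∏ t' ∈ Ω with 0 < dist (t : UnitAddCircle) t' ∧ dist (t : UnitAddCircle) t' ≤ 1 / N,
    1 / (N * dist (t : UnitAddCircle) t')

/-- The normalized minimal separation `N min_{t ≠ t'} dist t t'` of the nodes. -/
noncomputable def minimalSeparation (N : ℕ) (Ω : Finset UnitAddCircle) : ℝ :=
  N * (Ω : Set UnitAddCircle).infsep

/-- The clustered node configurations with fewer than `N` nodes, normalized minimal separation `τ` and
largest cluster of cardinality `m`, whose cluster separation satisfies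
`ρ ≥ 2 m (2 √2 m ^ m ζ(2) 𝒞) ^ (1/2)`, where `ζ(2) = π² / 6` and `𝒞` is the cluster complexity. -/
noncomputable def admissibleConfigurations (N m : ℕ) (τ : ℝ) : Set (Finset UnitAddCircle) :=
  {Ω | Ω.card < N ∧ minimalSeparation N Ω = τ ∧
    ∃ (L : ℕ) (Λ : Fin L → Finset UnitAddCircle), IsClusteredConfiguration N Ω Λ ∧
      IsGreatest (Set.range fun l => (Λ l).card) m ∧
      ENNReal.ofReal (2 * m *
        √(2 * √2 * (m : ℝ) ^ m * (Real.pi ^ 2 / 6) * clusterComplexity N Ω)) ≤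
          clusterSeparation N Λ}

/-! The lower bound is a duality argument. Write `z_s` for the point of the unit circle belonging to
the node `s`, and take `n` about `N / (m + 3)`. For each `s` there is a polynomial `P_s` of degree
below `N` with value `1` at `z_s`, vanishing at the other nodes of the cluster of `s` and small at
all remaining nodes: a Lagrange product in the variable `z ^ n`, times the fourth power of a
Dirichlet kernel of order `n` centred at `s`. Put `q = ∑ v_s P_s`. Pairing the values of `q` at the
nodes with `v` gives at least `‖v‖² / 2`, because the matrix of values `P_s(z_t)` is close to the
identity. The same pairing is an inner product of `A* v` with the coefficients of `q`, so
Cauchy–Schwarz and an upper bound for the coefficients bound `‖A* v‖` from below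
(`norm_sq_vandermonde_lower_bound`).

Everything depends on a bound `B` for the Lagrange products, and two different ones are used. The
bound `B ≲ 𝒞` makes the errors at distant nodes negligible: the separation `ρ` satisfies `ρ² ≥ 𝒞`,
fourth-order decay gains `𝒞⁻²`, and `𝒞 ≥ 1 / τ` is large. The bound `B ≤ (2 / τ) ^ (m - 1) * exp (m
+ 3)` gives the final estimate; the factorial from packing `τ`-separated points on a line absorbs
the power of `m + 3`, so the constant stays absolute (`sqrt_mul_pow_le_sigmaMin`).

For the upper bound, `m` equispaced nodes form one admissible cluster, and alternating binomial
coefficients turn `A* v` into a finite difference of order `m - 1` (`sigmaMin_equispacedNodes_le`).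

The minimum exists because the attained values form a finite union of continuous images of compact
sets of node families (`isCompact_image_admissibleConfigurations`). -/

/-! ### Distances on the circle and chord lengths -/

theorem UnitAddCircle.exists_coe_eq_norm_eq_abs (y : UnitAddCircle) :
    ∃ r : ℝ, (r : UnitAddCircle) = y ∧ ‖y‖ = |r| ∧ |r| ≤ 1 / 2 := by
  obtain ⟨r, rfl⟩ := QuotientAddGroup.mk_surjective y
  refine ⟨r - round r, ?_, UnitAddCircle.norm_eq, abs_sub_round r⟩
  have h : ((round r : ℝ) : UnitAddCircle) = 0 := by
    rw [AddCircle.coe_eq_zero_iff]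
    exact ⟨round r, by simp⟩
  change ((r - round r : ℝ) : UnitAddCircle) = (r : UnitAddCircle)
  rw [AddCircle.coe_sub, h, sub_zero]

theorem UnitAddCircle.norm_coe_of_abs_le {x : ℝ} (hx : |x| ≤ 1 / 2) :
    ‖(x : UnitAddCircle)‖ = |x| := by
  rw [AddCircle.norm_coe_eq_abs_iff _ one_ne_zero]
  simpa using hx

theorem UnitAddCircle.norm_coe_le_abs (x : ℝ) : ‖(x : UnitAddCircle)‖ ≤ |x| := by
  rw [UnitAddCircle.norm_eq]
  simpa using round_le x 0

theorem UnitAddCircle.norm_le_half (y : UnitAddCircle) : ‖y‖ ≤ 1 / 2 := by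
  simpa using AddCircle.norm_le_half_period 1 one_ne_zero (x := y)

/-- The chord has length `2 |sin (π x)|`, and Jordan's inequality applies on this range. -/
theorem four_mul_abs_le_norm_circleExp_sub_one {x : ℝ} (hx : |x| ≤ 1 / 2) :
    4 * |x| ≤ ‖(Circle.exp (2 * Real.pi * x) : ℂ) - 1‖ := by
  have hpi := Real.pi_pos
  rw [Circle.coe_exp, mul_comm _ Complex.I, Complex.norm_exp_I_mul_ofReal_sub_one, norm_mul,
    Real.norm_eq_abs, Real.norm_eq_abs, abs_two]
  have h1 : |2 * Real.pi * x / 2| = Real.pi * |x| := by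
    rw [show 2 * Real.pi * x / 2 = Real.pi * x by ring, abs_mul, abs_of_pos hpi]
  have h2 := Real.mul_abs_le_abs_sin (x := 2 * Real.pi * x / 2) (by rw [h1]; nlinarith)
  rw [h1] at h2
  have h3 : 2 / Real.pi * (Real.pi * |x|) = 2 * |x| := by field_simp
  linarith

theorem AddCircle.four_mul_norm_le_norm_toCircle_pow_sub_one {n : ℕ} {y : UnitAddCircle}
    (h : n * ‖y‖ ≤ 1 / 2) : 4 * (n * ‖y‖) ≤ ‖(AddCircle.toCircle y : ℂ) ^ n - 1‖ := by
  obtain ⟨r, rfl, hr, -⟩ := UnitAddCircle.exists_coe_eq_norm_eq_abs y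
  have h1 : (AddCircle.toCircle (r : UnitAddCircle) : ℂ) ^ n =
      Circle.exp (2 * Real.pi * (n * r)) := by
    rw [← Circle.coe_pow, AddCircle.toCircle_apply_mk, ← Circle.exp_nsmul]
    congr 2
    simp
    ring
  have h2 : |n * r| = n * |r| := by rw [abs_mul, Nat.abs_cast]
  rw [hr] at h ⊢
  rw [h1, ← h2]
  exact four_mul_abs_le_norm_circleExp_sub_one (h2 ▸ h)

theorem AddCircle.coe_toCircle_sub (x y : UnitAddCircle) :
    (AddCircle.toCircle (x - y) : ℂ) =
      AddCircle.toCircle x * (starRingEnd ℂ) (AddCircle.toCircle y) := by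
  rw [sub_eq_add_neg, AddCircle.toCircle_add, AddCircle.toCircle_neg, Circle.coe_mul,
    Circle.coe_inv_eq_conj]

theorem AddCircle.four_mul_dist_le_norm_toCircle_pow_sub {n : ℕ} {x y : UnitAddCircle}
    (h : n * dist x y ≤ 1 / 2) :
    4 * (n * dist x y) ≤
      ‖(AddCircle.toCircle x : ℂ) ^ n - (AddCircle.toCircle y : ℂ) ^ n‖ := by
  rw [dist_eq_norm] at *
  refine (AddCircle.four_mul_norm_le_norm_toCircle_pow_sub_one h).trans_eq ?_
  have h1 : (AddCircle.toCircle x : ℂ) = AddCircle.toCircle (x - y) * AddCircle.toCircle y := by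
    rw [← Circle.coe_mul, ← AddCircle.toCircle_add, sub_add_cancel]
  rw [h1, mul_pow, ← sub_one_mul, norm_mul, norm_pow, Circle.norm_coe, one_pow, mul_one]

/-! ### Dirichlet kernels and the discrete Parseval identity -/

/-- The normalized Dirichlet kernel of order `n` centred at the node `t`, as a polynomial. -/
noncomputable def dirichletPolynomial (n : ℕ) (t : UnitAddCircle) : Polynomial ℂ :=
  ∑ k ∈ Finset.range n,
    Polynomial.monomial k ((n : ℂ)⁻¹ * (starRingEnd ℂ) (AddCircle.toCircle t : ℂ) ^ k)

theorem dirichletPolynomial_natDegree_le (n : ℕ) (t : UnitAddCircle) :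
    (dirichletPolynomial n t).natDegree ≤ n - 1 := by
  refine Polynomial.natDegree_sum_le_of_forall_le _ _ fun k hk => ?_
  have := Finset.mem_range.1 hk
  exact (Polynomial.natDegree_monomial_le _).trans (by omega)

theorem dirichletPolynomial_coeff (n : ℕ) (t : UnitAddCircle) (k : ℕ) :
    (dirichletPolynomial n t).coeff k =
      if k < n then (n : ℂ)⁻¹ * (starRingEnd ℂ) (AddCircle.toCircle t : ℂ) ^ k else 0 := by
  simp [dirichletPolynomial, Polynomial.finsetSum_coeff, Polynomial.coeff_monomial]

theorem dirichletPolynomial_eval (n : ℕ) (t x : UnitAddCircle) :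
    (dirichletPolynomial n t).eval (AddCircle.toCircle x : ℂ) =
      (n : ℂ)⁻¹ * ∑ k ∈ Finset.range n, (AddCircle.toCircle (x - t) : ℂ) ^ k := by
  rw [dirichletPolynomial, Polynomial.eval_finsetSum, Finset.mul_sum]
  refine Finset.sum_congr rfl fun k _ => ?_
  rw [Polynomial.eval_monomial, AddCircle.coe_toCircle_sub, mul_pow]
  ring

theorem dirichletPolynomial_eval_self {n : ℕ} (hn : 0 < n) (t : UnitAddCircle) :
    (dirichletPolynomial n t).eval (AddCircle.toCircle t : ℂ) = 1 := by
  rw [dirichletPolynomial_eval]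
  have : (n : ℂ) ≠ 0 := by exact_mod_cast hn.ne'
  simp [this]

theorem norm_dirichletPolynomial_eval_le_one {n : ℕ} (hn : 0 < n) (t x : UnitAddCircle) :
    ‖(dirichletPolynomial n t).eval (AddCircle.toCircle x : ℂ)‖ ≤ 1 := by
  rw [dirichletPolynomial_eval, norm_mul, norm_inv, Complex.norm_natCast]
  have h := norm_sum_le (Finset.range n) fun k => (AddCircle.toCircle (x - t) : ℂ) ^ k
  simp only [norm_pow, Circle.norm_coe, one_pow, Finset.sum_const, Finset.card_range,
    nsmul_eq_mul, mul_one] at h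
  have hn' : (0 : ℝ) < n := by exact_mod_cast hn
  calc _ ≤ (n : ℝ)⁻¹ * n := by gcongr
    _ = 1 := inv_mul_cancel₀ hn'.ne'

/-- In the closed form of the geometric sum the numerator is at most `2` and the denominator is a
chord of length at least `4 * dist x t`. -/
theorem norm_dirichletPolynomial_eval_le {n : ℕ} (hn : 0 < n) {t x : UnitAddCircle}
    (hx : x ≠ t) :
    ‖(dirichletPolynomial n t).eval (AddCircle.toCircle x : ℂ)‖ ≤ 1 / (2 * n * dist x t) := by
  have hn' : (0 : ℝ) < n := by exact_mod_cast hn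
  have hd : 0 < dist x t := dist_pos.2 hx
  have h4 := AddCircle.four_mul_norm_le_norm_toCircle_pow_sub_one (n := 1) (y := x - t)
    (by simpa using UnitAddCircle.norm_le_half (x - t))
  rw [← dist_eq_norm, Nat.cast_one, one_mul, pow_one] at h4
  rw [dirichletPolynomial_eval]
  have hw1 : ‖(AddCircle.toCircle (x - t) : ℂ)‖ = 1 := Circle.norm_coe _
  generalize (AddCircle.toCircle (x - t) : ℂ) = w at h4 hw1 ⊢
  have hw : w ≠ 1 := by
    intro h
    rw [h, sub_self, norm_zero] at h4
    linarith
  have h2 : ‖w ^ n - 1‖ ≤ 2 := by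
    refine (norm_sub_le _ _).trans ?_
    rw [norm_pow, hw1, one_pow, norm_one]
    norm_num
  rw [geom_sum_eq hw, norm_mul, norm_inv, Complex.norm_natCast, norm_div]
  calc (n : ℝ)⁻¹ * (‖w ^ n - 1‖ / ‖w - 1‖) ≤ (n : ℝ)⁻¹ * (2 / (4 * dist x t)) := by gcongr
    _ = 1 / (2 * n * dist x t) := by field_simp; norm_num

theorem IsPrimitiveRoot.sum_pow_mul_conj_pow {N : ℕ} (hN : 0 < N) {ω : ℂ}
    (hω : IsPrimitiveRoot ω N) {k l : ℕ} (hk : k < N) (hl : l < N) :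
    ∑ j ∈ Finset.range N, (ω ^ j) ^ k * (starRingEnd ℂ) ((ω ^ j) ^ l) =
      if k = l then (N : ℂ) else 0 := by
  have hω1 : ‖ω‖ = 1 := hω.norm'_eq_one hN.ne'
  have hω0 : ω ≠ 0 := by intro h; simp [h] at hω1
  have hconj : (starRingEnd ℂ) ω = ω⁻¹ := by
    rw [Complex.inv_def, Complex.normSq_eq_norm_sq, hω1]; simp
  have hterm : ∀ j, (ω ^ j) ^ k * (starRingEnd ℂ) ((ω ^ j) ^ l) = (ω ^ k * (ω ^ l)⁻¹) ^ j := by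
    intro j
    simp only [map_pow, hconj, mul_pow, inv_pow, ← pow_mul, mul_comm j]
  simp only [hterm]
  split_ifs with h
  · subst h
    simp [mul_inv_cancel₀ (pow_ne_zero k hω0)]
  · have hne : ω ^ k * (ω ^ l)⁻¹ ≠ 1 := fun h' => h (hω.pow_inj hk hl (by
      rwa [mul_inv_eq_one₀ (pow_ne_zero l hω0)] at h'))
    rw [geom_sum_eq hne, mul_pow, inv_pow, ← pow_mul, ← pow_mul, mul_comm k, mul_comm l,
      pow_mul, pow_mul, hω.pow_eq_one]
    simp

/-- Discrete Parseval identity on the grid of `N`-th roots of unity. -/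
theorem Polynomial.sum_norm_sq_eval_roots {N : ℕ} {ω : ℂ} (hω : IsPrimitiveRoot ω N)
    {p : Polynomial ℂ} (hp : p.natDegree < N) :
    ∑ j ∈ Finset.range N, ‖p.eval (ω ^ j)‖ ^ 2 =
      N * ∑ k ∈ Finset.range N, ‖p.coeff k‖ ^ 2 := by
  have hN : 0 < N := by omega
  have hsq : ∀ z : ℂ, ((‖z‖ ^ 2 : ℝ) : ℂ) = z * (starRingEnd ℂ) z := fun z => by
    rw [Complex.mul_conj, Complex.normSq_eq_norm_sq]
  rw [← Complex.ofReal_inj]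
  push_cast [-Complex.ofReal_pow]
  simp only [hsq, Polynomial.eval_eq_sum_range' hp]
  simp only [map_sum, map_mul, Finset.sum_mul_sum]
  rw [Finset.sum_comm, Finset.mul_sum]
  refine Finset.sum_congr rfl fun k hk => ?_
  rw [Finset.sum_comm]
  calc _ = ∑ l ∈ Finset.range N, (p.coeff k * (starRingEnd ℂ) (p.coeff l)) *
        ∑ j ∈ Finset.range N, (ω ^ j) ^ k * (starRingEnd ℂ) ((ω ^ j) ^ l) := by
        refine Finset.sum_congr rfl fun l _ => ?_
        rw [Finset.mul_sum]
        exact Finset.sum_congr rfl fun j _ => by ring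
    _ = ∑ l ∈ Finset.range N, (p.coeff k * (starRingEnd ℂ) (p.coeff l)) *
          if k = l then (N : ℂ) else 0 :=
        Finset.sum_congr rfl fun l hl => by
          rw [hω.sum_pow_mul_conj_pow hN (Finset.mem_range.1 hk) (Finset.mem_range.1 hl)]
    _ = _ := by
        simp only [mul_ite, mul_zero, Finset.sum_ite_eq, hk, if_true]
        ring

theorem sum_norm_sq_dirichletPolynomial_eval_roots {N n : ℕ} {ω : ℂ} (hω : IsPrimitiveRoot ω N)
    (hn : 0 < n) (hnN : n ≤ N) (t : UnitAddCircle) :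
    ∑ j ∈ Finset.range N, ‖(dirichletPolynomial n t).eval (ω ^ j)‖ ^ 2 = N / n := by
  have hn' : (0 : ℝ) < n := by exact_mod_cast hn
  rw [Polynomial.sum_norm_sq_eval_roots hω
    ((dirichletPolynomial_natDegree_le n t).trans_lt (by omega))]
  have h : ∀ k ∈ Finset.range N, ‖(dirichletPolynomial n t).coeff k‖ ^ 2 =
      if k < n then ((n : ℝ)⁻¹) ^ 2 else 0 := by
    intro k _
    rw [dirichletPolynomial_coeff]
    split_ifs
    · rw [norm_mul, norm_pow, RCLike.norm_conj, Circle.norm_coe]; simp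
    · simp
  have h2 : (Finset.range N).filter (· < n) = Finset.range n := by
    ext k; simp only [Finset.mem_filter, Finset.mem_range]; omega
  rw [Finset.sum_congr rfl h, ← Finset.sum_filter, h2, Finset.sum_const, Finset.card_range,
    nsmul_eq_mul]
  field_simp

/-! ### Sums of decaying functions over sparsely packed nodes -/

theorem sum_one_div_pow_four_le (J : ℕ) :
    ∑ j ∈ Finset.range J, (1 / (j : ℝ)) ^ 4 ≤ 2 := by
  -- The term `j = 0` vanishes since `1 / 0 = 0`; the subtracted term telescopes.
  have key : ∀ J : ℕ, ∑ j ∈ Finset.range (J + 2), (1 / (j : ℝ)) ^ 4 ≤ 2 - 1 / ((J : ℝ) + 1) := by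
    intro J
    induction J with
    | zero => norm_num [Finset.sum_range_succ]
    | succ J ih =>
      rw [Finset.sum_range_succ]
      have hJ : (0 : ℝ) ≤ J := J.cast_nonneg
      have h1 : (1 / (J + 2 : ℝ)) ^ 4 ≤ 1 / (J + 1) - 1 / (J + 1 + 1) := by
        rw [div_sub_div _ _ (by positivity) (by positivity), div_pow,
          div_le_div_iff₀ (by positivity) (by positivity)]
        ring_nf
        nlinarith [pow_nonneg hJ 2, pow_nonneg hJ 3, pow_nonneg hJ 4]
      push_cast
      linarith
  have hm : ∑ j ∈ Finset.range J, (1 / (j : ℝ)) ^ 4 ≤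
      ∑ j ∈ Finset.range (J + 2), (1 / (j : ℝ)) ^ 4 :=
    Finset.sum_le_sum_of_subset_of_nonneg (Finset.range_subset_range.2 (by omega))
      fun _ _ _ => by positivity
  have := key J
  have : (0 : ℝ) < 1 / ((J : ℝ) + 1) := by positivity
  linarith

/-- If balls of a set of circle points of diameter less than `δ` have at most `m` elements, then sums
of functions decaying to fourth order away from `x` are controlled. -/
theorem sum_le_of_decay_of_dist {Ω : Finset UnitAddCircle} {m : ℕ} {δ c : ℝ} (hδ : 0 < δ)
    (hc : 0 ≤ c) (hΩ : ∀ T ⊆ Ω, (∀ s ∈ T, ∀ s' ∈ T, dist s s' < δ) → T.card ≤ m)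
    (x : UnitAddCircle) {F : UnitAddCircle → ℝ}
    (hF : ∀ s ∈ Ω, F s ≤ (c / dist x s) ^ 4) (hfar : ∀ s ∈ Ω, δ ≤ dist x s) :
    ∑ s ∈ Ω, F s ≤ 4 * m * (c / δ) ^ 4 := by
  classical
  choose r hr hrn hr2 using fun s => UnitAddCircle.exists_coe_eq_norm_eq_abs (x - s)
  have hdist : ∀ s, dist x s = |r s| := fun s => by rw [dist_eq_norm, hrn]
  -- Nodes are sorted by side of `x` and by distance in steps of `δ`. Each cell has diameter below
  -- `δ`, hence at most `m` nodes; cells with `j = 0` are empty by `hfar`.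
  let b : UnitAddCircle → Bool × ℕ := fun s => (decide (0 ≤ r s), ⌊|r s| / δ⌋₊)
  obtain ⟨J, hJ⟩ : ∃ J : ℕ, ∀ s ∈ Ω, ⌊|r s| / δ⌋₊ < J := by
    refine ⟨⌊(1 / 2) / δ⌋₊ + 1, fun s _ => Nat.lt_succ_of_le (Nat.floor_le_floor ?_)⟩
    have := hr2 s
    gcongr
  have hmaps : ∀ s ∈ Ω, b s ∈ (Finset.univ : Finset Bool) ×ˢ Finset.range J := fun s hs => by
    exact Finset.mem_product.2 ⟨Finset.mem_univ _, Finset.mem_range.2 (hJ s hs)⟩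
  rw [← Finset.sum_fiberwise_of_maps_to hmaps, Finset.sum_product]
  have hfib : ∀ e : Bool, ∀ j : ℕ, ∑ s ∈ Ω with b s = (e, j), F s ≤
      m * ((c / δ) ^ 4 * (1 / (j : ℝ)) ^ 4) := by
    intro e j
    have hcard : (Ω.filter fun s => b s = (e, j)).card ≤ m := by
      refine hΩ _ (Finset.filter_subset _ _) fun s hs s' hs' => ?_
      simp only [Finset.mem_filter, b, Prod.mk.injEq] at hs hs'
      have h1 := Nat.floor_le (div_nonneg (abs_nonneg (r s)) hδ.le)
      have h2 := Nat.lt_floor_add_one (|r s| / δ)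
      have h3 := Nat.floor_le (div_nonneg (abs_nonneg (r s')) hδ.le)
      have h4 := Nat.lt_floor_add_one (|r s'| / δ)
      rw [hs.2.2, le_div_iff₀ hδ] at h1
      rw [hs.2.2, div_lt_iff₀ hδ] at h2
      rw [hs'.2.2, le_div_iff₀ hδ] at h3
      rw [hs'.2.2, div_lt_iff₀ hδ] at h4
      have h5 : s - s' = ((r s' - r s : ℝ) : UnitAddCircle) := by
        rw [AddCircle.coe_sub, hr, hr]; abel
      rw [dist_eq_norm, h5]
      refine (UnitAddCircle.norm_coe_le_abs _).trans_lt ?_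
      have h6 : (0 ≤ r s ↔ 0 ≤ r s') := by
        have := hs.2.1.trans hs'.2.1.symm
        simpa using this
      rw [abs_lt]
      by_cases h : 0 ≤ r s
      · rw [abs_of_nonneg h] at h1 h2
        rw [abs_of_nonneg (h6.1 h)] at h3 h4
        constructor <;> linarith
      · rw [abs_of_neg (not_le.1 h)] at h1 h2
        rw [abs_of_neg (not_le.1 fun h' => h (h6.2 h'))] at h3 h4
        constructor <;> linarith
    have hle : ∀ s ∈ Ω.filter fun s => b s = (e, j), F s ≤ (c / δ) ^ 4 * (1 / (j : ℝ)) ^ 4 := by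
      intro s hs
      simp only [Finset.mem_filter, b, Prod.mk.injEq] at hs
      refine (hF s hs.1).trans ?_
      have h1 := Nat.floor_le (div_nonneg (abs_nonneg (r s)) hδ.le)
      have hj : 1 ≤ j := by
        rw [← hs.2.2, Nat.one_le_floor_iff, one_le_div hδ, ← hdist]
        exact hfar s hs.1
      have hj' : (0 : ℝ) < j := by exact_mod_cast hj
      rw [hs.2.2, le_div_iff₀ hδ, ← hdist] at h1
      rw [← mul_pow, div_mul_div_comm, mul_one]
      have : 0 < δ * j := by positivity
      have h2 : δ * j ≤ dist x s := by linarith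
      gcongr
    refine (Finset.sum_le_card_nsmul _ _ _ hle).trans ?_
    rw [nsmul_eq_mul]
    gcongr
  calc _ ≤ ∑ e : Bool, ∑ j ∈ Finset.range J, (m : ℝ) * ((c / δ) ^ 4 * (1 / (j : ℝ)) ^ 4) :=
        Finset.sum_le_sum fun e _ => Finset.sum_le_sum fun j _ => hfib e j
    _ = 2 * (m * ((c / δ) ^ 4 * ∑ j ∈ Finset.range J, (1 / (j : ℝ)) ^ 4)) := by
        rw [Finset.sum_const, ← Finset.mul_sum, ← Finset.mul_sum]; simp
    _ ≤ 2 * (m * ((c / δ) ^ 4 * 2)) := by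
        have := sum_one_div_pow_four_le J
        gcongr
    _ = _ := by ring

/-- The nodes within `δ` of `x` split into two half-arcs with at most `m` nodes each, which accounts
for the term `2 * m`. -/
theorem sum_le_of_decay {Ω : Finset UnitAddCircle} {m : ℕ} {δ c : ℝ} (hδ : 0 < δ)
    (hc : 0 ≤ c) (hΩ : ∀ T ⊆ Ω, (∀ s ∈ T, ∀ s' ∈ T, dist s s' < δ) → T.card ≤ m)
    (x : UnitAddCircle) {F : UnitAddCircle → ℝ} (hF1 : ∀ s ∈ Ω, F s ≤ 1)
    (hF : ∀ s ∈ Ω, x ≠ s → F s ≤ (c / dist x s) ^ 4) :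
    ∑ s ∈ Ω, F s ≤ 2 * m + 4 * m * (c / δ) ^ 4 := by
  classical
  rw [← Finset.sum_filter_add_sum_filter_not Ω (fun s => dist x s < δ)]
  refine add_le_add ?_ (sum_le_of_decay_of_dist hδ hc
    (fun T hT => hΩ T (hT.trans (Finset.filter_subset _ _))) x (fun s hs => ?_) fun s hs => ?_)
  · choose r hr hrn hr2 using fun s => UnitAddCircle.exists_coe_eq_norm_eq_abs (x - s)
    have hdist : ∀ s, dist x s = |r s| := fun s => by rw [dist_eq_norm, hrn]
    have hcard : ∀ T ⊆ Ω, ∀ e : ℝ, (∀ s ∈ T, e ≤ r s ∧ r s < e + δ) → T.card ≤ m := by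
      refine fun T hT e he => hΩ T hT fun s hs s' hs' => ?_
      have h5 : s - s' = ((r s' - r s : ℝ) : UnitAddCircle) := by
        rw [AddCircle.coe_sub, hr, hr]; abel
      rw [dist_eq_norm, h5]
      refine (UnitAddCircle.norm_coe_le_abs _).trans_lt ?_
      have := he s hs
      have := he s' hs'
      rw [abs_lt]; constructor <;> linarith
    set S := Ω.filter fun s => dist x s < δ with hS
    have hSΩ : S ⊆ Ω := Finset.filter_subset _ _
    have hSd : ∀ s ∈ S, |r s| < δ := fun s hs => by
      rw [← hdist]; exact (Finset.mem_filter.1 hs).2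
    have h1 : (S.filter fun s => 0 ≤ r s).card ≤ m := by
      refine hcard _ ((Finset.filter_subset _ _).trans hSΩ) 0 fun s hs => ?_
      rw [Finset.mem_filter] at hs
      have := abs_lt.1 (hSd s hs.1)
      exact ⟨hs.2, by linarith⟩
    have h2 : (S.filter fun s => ¬ 0 ≤ r s).card ≤ m := by
      refine hcard _ ((Finset.filter_subset _ _).trans hSΩ) (-δ) fun s hs => ?_
      rw [Finset.mem_filter] at hs
      have := abs_lt.1 (hSd s hs.1)
      exact ⟨this.1.le, by linarith [not_le.1 hs.2]⟩
    have h3 : S.card ≤ 2 * m := by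
      rw [← Finset.card_filter_add_card_filter_not (s := S) (fun s => 0 ≤ r s)]
      omega
    calc ∑ s ∈ S, F s ≤ S.card • (1 : ℝ) :=
          Finset.sum_le_card_nsmul _ _ _ fun s hs => hF1 s (hSΩ hs)
      _ ≤ 2 * m := by rw [nsmul_eq_mul, mul_one]; exact_mod_cast h3
  · rw [Finset.mem_filter] at hs
    refine hF s hs.1 ?_
    rintro rfl
    simp [hδ] at hs
  · exact not_lt.1 (Finset.mem_filter.1 hs).2

/-! ### Localized interpolating polynomials -/

open Classical in
/-- The polynomial which is `1` at the node `t`, vanishes at the other nodes of `K`, and is localized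
around `t`. -/
noncomputable def localizedPolynomial (n : ℕ) (K : Finset UnitAddCircle) (t : UnitAddCircle) :
    Polynomial ℂ :=
  (∏ s ∈ K.erase t,
    Polynomial.C (((AddCircle.toCircle t : ℂ) ^ n - (AddCircle.toCircle s : ℂ) ^ n)⁻¹) *
      (Polynomial.X ^ n - Polynomial.C ((AddCircle.toCircle s : ℂ) ^ n))) *
    dirichletPolynomial n t ^ 4

/-- At most `m - 1` Lagrange factors of degree `n` and four kernels of degree at most `n - 1` fit
below `(m + 3) * n`; this is where `m + 3` comes from. -/
theorem localizedPolynomial_natDegree_lt {n m N : ℕ} (hn : 0 < n) (hnN : (m + 3) * n ≤ N)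
    {K : Finset UnitAddCircle} {t : UnitAddCircle} (ht : t ∈ K) (hK : K.card ≤ m) :
    (localizedPolynomial n K t).natDegree < N := by
  classical
  have h1 : (∏ s ∈ K.erase t,
      Polynomial.C (((AddCircle.toCircle t : ℂ) ^ n - (AddCircle.toCircle s : ℂ) ^ n)⁻¹) *
      (Polynomial.X ^ n - Polynomial.C ((AddCircle.toCircle s : ℂ) ^ n))).natDegree ≤
      (K.card - 1) * n := by
    refine (Polynomial.natDegree_prod_le _ _).trans ?_
    rw [← Finset.card_erase_of_mem ht, ← smul_eq_mul]
    refine Finset.sum_le_card_nsmul _ _ _ fun s _ => ?_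
    refine (Polynomial.natDegree_C_mul_le _ _).trans ?_
    rw [Polynomial.natDegree_X_pow_sub_C]
  have h2 : (dirichletPolynomial n t ^ 4).natDegree ≤ 4 * (n - 1) :=
    Polynomial.natDegree_pow_le.trans
      (Nat.mul_le_mul_left _ (dirichletPolynomial_natDegree_le n t))
  have h3 : (localizedPolynomial n K t).natDegree ≤ (K.card - 1) * n + 4 * (n - 1) := by
    unfold localizedPolynomial
    refine Polynomial.natDegree_mul_le.trans (add_le_add (le_of_eq_of_le ?_ h1) h2)
    congr!
  have h4 : (K.card - 1) * n ≤ (m - 1) * n := Nat.mul_le_mul_right _ (by omega)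
  have hm : 1 ≤ m := (Finset.card_pos.2 ⟨t, ht⟩).trans_le hK
  obtain ⟨m, rfl⟩ := Nat.exists_eq_add_of_le' hm
  have h5 : (m + 1 + 3) * n = m * n + 4 * n := by ring
  rw [Nat.add_sub_cancel] at h4
  omega

theorem localizedPolynomial_eval {n : ℕ} (K : Finset UnitAddCircle) (t : UnitAddCircle) (z : ℂ) :
    (localizedPolynomial n K t).eval z =
      (∏ s ∈ (K.filter (· ≠ t)), ((AddCircle.toCircle t : ℂ) ^ n - (AddCircle.toCircle s : ℂ) ^ n)⁻¹ *
        (z ^ n - (AddCircle.toCircle s : ℂ) ^ n)) * (dirichletPolynomial n t).eval z ^ 4 := by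
  classical
  rw [localizedPolynomial, Polynomial.eval_mul, Polynomial.eval_pow, Polynomial.eval_prod]
  congr 1
  refine Finset.prod_congr ?_ fun s _ => by simp
  ext s
  simp [and_comm]

theorem localizedPolynomial_eval_self {n : ℕ} (hn : 0 < n) {K : Finset UnitAddCircle}
    {t : UnitAddCircle} (hK : ∀ s ∈ K, n * dist t s ≤ 1 / 2) :
    (localizedPolynomial n K t).eval (AddCircle.toCircle t : ℂ) = 1 := by
  rw [localizedPolynomial_eval, dirichletPolynomial_eval_self hn, one_pow, mul_one]
  refine Finset.prod_eq_one fun s hs => inv_mul_cancel₀ ?_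
  rw [Finset.mem_filter] at hs
  have h := AddCircle.four_mul_dist_le_norm_toCircle_pow_sub (hK s hs.1)
  have h1 : 0 < dist t s := dist_pos.2 (Ne.symm hs.2)
  have h2 : (0 : ℝ) < n := by exact_mod_cast hn
  rw [← norm_pos_iff]
  exact lt_of_lt_of_le (by positivity) h

theorem localizedPolynomial_eval_eq_zero {n : ℕ} {K : Finset UnitAddCircle}
    {t s : UnitAddCircle} (hs : s ∈ K) (hst : s ≠ t) :
    (localizedPolynomial n K t).eval (AddCircle.toCircle s : ℂ) = 0 := by
  rw [localizedPolynomial_eval,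
    Finset.prod_eq_zero (i := s) (by simp [hs, hst]) (by simp), zero_mul]

/-- Using `z ^ n` in place of `z` stretches node distances by `n`, while each numerator stays at
most `2` on the whole unit circle. A factor is thus at most `2 / (4 * n * dist t s)`. -/
theorem norm_localizedPolynomial_eval_le {n : ℕ} (hn : 0 < n) {K : Finset UnitAddCircle}
    {t : UnitAddCircle} (hK : ∀ s ∈ K, n * dist t s ≤ 1 / 2) {B : ℝ}
    (hB : ∏ s ∈ K.filter (· ≠ t), 1 / (2 * n * dist t s) ≤ B) {z : ℂ} (hz : ‖z‖ = 1) :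
    ‖(localizedPolynomial n K t).eval z‖ ≤ B * ‖(dirichletPolynomial n t).eval z‖ ^ 4 := by
  rw [localizedPolynomial_eval, norm_mul, norm_pow, norm_prod]
  refine mul_le_mul_of_nonneg_right (le_trans ?_ hB) (by positivity)
  refine Finset.prod_le_prod (fun _ _ => norm_nonneg _) fun s hs => ?_
  rw [Finset.mem_filter] at hs
  have h := AddCircle.four_mul_dist_le_norm_toCircle_pow_sub (hK s hs.1)
  have h1 : 0 < dist t s := dist_pos.2 (Ne.symm hs.2)
  have h2 : (0 : ℝ) < n := by exact_mod_cast hn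
  have h3 : ‖z ^ n - (AddCircle.toCircle s : ℂ) ^ n‖ ≤ 2 := by
    refine (norm_sub_le _ _).trans ?_
    rw [norm_pow, norm_pow, hz, Circle.norm_coe, one_pow]
    norm_num
  rw [norm_mul, norm_inv]
  calc _ ≤ (4 * (n * dist t s))⁻¹ * 2 := by gcongr
    _ = _ := by field_simp; norm_num

/-! ### The duality argument for the lower bound -/

/-- Schur test for a symmetric nonnegative kernel, by `2ab ≤ a² + b²`. -/
theorem sum_norm_mul_norm_mul_le {ι : Type*} {Ω : Finset ι} {G : ι → ι → ℝ} {b : ℝ}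
    (hG0 : ∀ t s, 0 ≤ G t s) (hGsymm : ∀ t s, G t s = G s t)
    (hG : ∀ t ∈ Ω, ∑ s ∈ Ω, G t s ≤ b) (v : ι → ℂ) :
    ∑ t ∈ Ω, ∑ s ∈ Ω, ‖v t‖ * ‖v s‖ * G t s ≤ b * ∑ t ∈ Ω, ‖v t‖ ^ 2 := by
  have h1 : ∑ t ∈ Ω, ∑ s ∈ Ω, ‖v t‖ ^ 2 * G t s ≤ b * ∑ t ∈ Ω, ‖v t‖ ^ 2 := by
    rw [Finset.mul_sum]
    refine Finset.sum_le_sum fun t ht => ?_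
    rw [← Finset.mul_sum, mul_comm b]
    exact mul_le_mul_of_nonneg_left (hG t ht) (by positivity)
  have h2 : ∑ t ∈ Ω, ∑ s ∈ Ω, ‖v s‖ ^ 2 * G t s = ∑ t ∈ Ω, ∑ s ∈ Ω, ‖v t‖ ^ 2 * G t s := by
    rw [Finset.sum_comm]
    simp only [hGsymm]
  have h3 : 2 * ∑ t ∈ Ω, ∑ s ∈ Ω, ‖v t‖ * ‖v s‖ * G t s ≤
      ∑ t ∈ Ω, ∑ s ∈ Ω, ‖v t‖ ^ 2 * G t s + ∑ t ∈ Ω, ∑ s ∈ Ω, ‖v s‖ ^ 2 * G t s := by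
    simp only [Finset.mul_sum, ← Finset.sum_add_distrib]
    refine Finset.sum_le_sum fun t _ => Finset.sum_le_sum fun s _ => ?_
    have := mul_nonneg (sq_nonneg (‖v t‖ - ‖v s‖)) (hG0 t s)
    linarith
  linarith

/-- The matrix of values of the localized polynomials at the nodes agrees with the identity inside
clusters. Across clusters its entries are dominated by a symmetric kernel with row sums at most `1 /
2`, so the quadratic form loses at most half. -/
theorem sum_eval_localizedPolynomial_bound {Ω : Finset UnitAddCircle} {n m : ℕ} {δ B : ℝ}
    (hn : 0 < n) (cl : UnitAddCircle → Finset UnitAddCircle)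
    (hclose : ∀ t ∈ Ω, ∀ s ∈ cl t, n * dist t s ≤ 1 / 2) (hδ : 0 < δ)
    (hfar : ∀ t ∈ Ω, ∀ s ∈ Ω, s ∉ cl t → δ ≤ dist t s) (hB0 : 0 ≤ B)
    (hB : ∀ t ∈ Ω, ∏ s ∈ (cl t).filter (· ≠ t), 1 / (2 * n * dist t s) ≤ B)
    (hpack : ∀ T ⊆ Ω, (∀ s ∈ T, ∀ s' ∈ T, dist s s' < δ) → T.card ≤ m)
    (hsmall : B * (4 * m * (1 / (2 * n) / δ) ^ 4) ≤ 1 / 2) (v : UnitAddCircle → ℂ) :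
    (∑ t ∈ Ω, ‖v t‖ ^ 2) / 2 ≤ ‖∑ t ∈ Ω, (starRingEnd ℂ) (v t) *
      ∑ s ∈ Ω, v s * (localizedPolynomial n (cl s) s).eval (AddCircle.toCircle t : ℂ)‖ := by
  classical
  set V := ∑ t ∈ Ω, ‖v t‖ ^ 2 with hV
  have hn' : (0 : ℝ) < n := by exact_mod_cast hn
  let G : UnitAddCircle → UnitAddCircle → ℝ := fun t s =>
    if δ ≤ dist t s then B * ((1 / (2 * n)) / dist t s) ^ 4 else 0
  have hG0 : ∀ t s, 0 ≤ G t s := fun t s => by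
    simp only [G]; split_ifs <;> positivity
  have hGsymm : ∀ t s, G t s = G s t := fun t s => by simp only [G, dist_comm]
  have hG : ∀ t ∈ Ω, ∑ s ∈ Ω, G t s ≤ 1 / 2 := by
    intro t _
    simp only [G]
    rw [← Finset.sum_filter, ← Finset.mul_sum]
    refine le_trans (mul_le_mul_of_nonneg_left ?_ hB0) hsmall
    refine sum_le_of_decay_of_dist hδ (by positivity)
      (fun T hT => hpack T (hT.trans (Finset.filter_subset _ _))) t (fun s _ => le_rfl) fun s hs => ?_
    exact (Finset.mem_filter.1 hs).2
  have hP : ∀ t ∈ Ω, ∀ s ∈ Ω,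
      ‖(localizedPolynomial n (cl s) s).eval (AddCircle.toCircle t : ℂ) - if t = s then 1 else 0‖ ≤
        G t s := by
    intro t ht s hs
    split_ifs with hts
    · subst hts
      rw [localizedPolynomial_eval_self hn (hclose t ht), sub_self, norm_zero]
      exact hG0 _ _
    rw [sub_zero]
    by_cases hcl : t ∈ cl s
    · rw [localizedPolynomial_eval_eq_zero hcl hts, norm_zero]
      exact hG0 _ _
    have hd := hfar s hs t ht hcl
    rw [dist_comm] at hd
    simp only [G, hd, if_true]
    refine (norm_localizedPolynomial_eval_le hn (hclose s hs) (hB s hs) (Circle.norm_coe _)).trans ?_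
    have := norm_dirichletPolynomial_eval_le hn hts
    rw [← div_div] at this
    gcongr
  have hdiag : ∑ t ∈ Ω, (starRingEnd ℂ) (v t) * ∑ s ∈ Ω, v s * (if t = s then 1 else 0) = (V : ℂ) := by
    rw [hV]
    push_cast
    refine Finset.sum_congr rfl fun t ht => ?_
    simp only [mul_ite, mul_one, mul_zero, Finset.sum_ite_eq, ht, if_true]
    rw [mul_comm, Complex.mul_conj, Complex.normSq_eq_norm_sq]
    push_cast
    rfl
  have hdiff : ‖∑ t ∈ Ω, (starRingEnd ℂ) (v t) *
      ∑ s ∈ Ω, v s * (localizedPolynomial n (cl s) s).eval (AddCircle.toCircle t : ℂ) - (V : ℂ)‖ ≤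
      1 / 2 * V := by
    rw [← hdiag, ← Finset.sum_sub_distrib]
    refine le_trans ?_ (sum_norm_mul_norm_mul_le hG0 hGsymm hG v)
    refine (norm_sum_le _ _).trans (Finset.sum_le_sum fun t ht => ?_)
    rw [← mul_sub, ← Finset.sum_sub_distrib, Finset.mul_sum]
    refine (norm_sum_le _ _).trans (Finset.sum_le_sum fun s hs => ?_)
    rw [← mul_sub, norm_mul, norm_mul, RCLike.norm_conj, ← mul_assoc]
    exact mul_le_mul_of_nonneg_left (hP t ht s hs) (by positivity)
  have hV0 : 0 ≤ V := Finset.sum_nonneg fun _ _ => by positivity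
  have h1 := norm_sub_norm_le (V : ℂ) (∑ t ∈ Ω, (starRingEnd ℂ) (v t) *
      ∑ s ∈ Ω, v s * (localizedPolynomial n (cl s) s).eval (AddCircle.toCircle t : ℂ))
  rw [norm_sub_rev, Complex.norm_real, Real.norm_of_nonneg hV0] at h1
  linarith

theorem AddCircle.exists_coe_toCircle_eq {z : ℂ} (hz : ‖z‖ = 1) :
    ∃ x : UnitAddCircle, (AddCircle.toCircle x : ℂ) = z := by
  refine ⟨((z.arg / (2 * Real.pi) : ℝ) : UnitAddCircle), ?_⟩
  have h := Complex.norm_mul_exp_arg_mul_I z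
  rw [hz, Complex.ofReal_one, one_mul] at h
  rw [AddCircle.toCircle_apply_mk, Circle.coe_exp, div_one,
    mul_div_cancel₀ _ (by positivity : (2 * Real.pi : ℝ) ≠ 0), h]

/-- By Parseval it suffices to bound `q` on the `N`-th roots of unity. With `κ s` the modulus of the
kernel at `s`, Cauchy–Schwarz gives `|q|² ≤ B² (∑ ‖v s‖² κ s ^ 4) (∑ κ s ^ 4)`. The last sum is at
most `4 * m` by packing, and in the other `κ s ^ 4 ≤ κ s ^ 2`, whose sum over the roots is `N / n`.
-/
theorem sum_norm_sq_coeff_localizedPolynomial_le {Ω : Finset UnitAddCircle} {N n m : ℕ} {δ B : ℝ}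
    (hn : 0 < n) (hnN : n ≤ N) (cl : UnitAddCircle → Finset UnitAddCircle)
    (hdeg : ∀ t ∈ Ω, (localizedPolynomial n (cl t) t).natDegree < N)
    (hclose : ∀ t ∈ Ω, ∀ s ∈ cl t, n * dist t s ≤ 1 / 2) (hδ : 0 < δ)
    (hB : ∀ t ∈ Ω, ∏ s ∈ (cl t).filter (· ≠ t), 1 / (2 * n * dist t s) ≤ B)
    (hpack : ∀ T ⊆ Ω, (∀ s ∈ T, ∀ s' ∈ T, dist s s' < δ) → T.card ≤ m)
    (hδn : (1 / (2 * n) / δ) ^ 4 ≤ 1 / 2) (v : UnitAddCircle → ℂ) :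
    n * ∑ k ∈ Finset.range N,
        ‖(∑ s ∈ Ω, Polynomial.C (v s) * localizedPolynomial n (cl s) s).coeff k‖ ^ 2 ≤
      4 * m * B ^ 2 * ∑ t ∈ Ω, ‖v t‖ ^ 2 := by
  set V := ∑ t ∈ Ω, ‖v t‖ ^ 2 with hV
  set q := ∑ s ∈ Ω, Polynomial.C (v s) * localizedPolynomial n (cl s) s with hq
  have hn' : (0 : ℝ) < n := by exact_mod_cast hn
  have hN : 0 < N := hn.trans_le hnN
  have hN' : (0 : ℝ) < N := by exact_mod_cast hN
  have hω := Complex.isPrimitiveRoot_exp N hN.ne'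
  set ω := Complex.exp (2 * Real.pi * Complex.I / N)
  have hx : ∀ j : ℕ, ∃ x : UnitAddCircle, (AddCircle.toCircle x : ℂ) = ω ^ j := by
    intro j
    exact AddCircle.exists_coe_toCircle_eq (by rw [norm_pow, hω.norm'_eq_one hN.ne', one_pow])
  have hqdeg : q.natDegree < N := by
    refine lt_of_le_of_lt (Polynomial.natDegree_sum_le_of_forall_le _ _ (n := N - 1) fun s hs => ?_)
      (by omega)
    have := Polynomial.natDegree_C_mul_le (v s) (localizedPolynomial n (cl s) s)
    have := hdeg s hs
    omega
  have hpt : ∀ j ∈ Finset.range N, ‖q.eval (ω ^ j)‖ ^ 2 ≤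
      4 * m * B ^ 2 * ∑ s ∈ Ω, ‖v s‖ ^ 2 * ‖(dirichletPolynomial n s).eval (ω ^ j)‖ ^ 2 := by
    intro j _
    obtain ⟨x, hxj⟩ := hx j
    rw [← hxj]
    set κ : UnitAddCircle → ℝ := fun s => ‖(dirichletPolynomial n s).eval (AddCircle.toCircle x : ℂ)‖
      with hκ
    have hκ0 : ∀ s, 0 ≤ κ s := fun s => norm_nonneg _
    have hκ1 : ∀ s, κ s ≤ 1 := fun s => norm_dirichletPolynomial_eval_le_one hn s x
    have h1 : ‖q.eval (AddCircle.toCircle x : ℂ)‖ ≤ B * ∑ s ∈ Ω, ‖v s‖ * κ s ^ 4 := by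
      rw [hq, Polynomial.eval_finsetSum, Finset.mul_sum]
      refine (norm_sum_le _ _).trans (Finset.sum_le_sum fun s hs => ?_)
      rw [Polynomial.eval_mul, Polynomial.eval_C, norm_mul, mul_left_comm]
      exact mul_le_mul_of_nonneg_left (norm_localizedPolynomial_eval_le hn (hclose s hs) (hB s hs)
        (Circle.norm_coe _)) (norm_nonneg _)
    have h2 : (∑ s ∈ Ω, ‖v s‖ * κ s ^ 4) ^ 2 ≤
        (∑ s ∈ Ω, ‖v s‖ ^ 2 * κ s ^ 4) * ∑ s ∈ Ω, κ s ^ 4 := by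
      have := Finset.sum_mul_sq_le_sq_mul_sq Ω (fun s => ‖v s‖ * κ s ^ 2) fun s => κ s ^ 2
      refine le_of_eq_of_le ?_ (this.trans_eq ?_)
      · congr 1; exact Finset.sum_congr rfl fun s _ => by ring
      · congr 1 <;> exact Finset.sum_congr rfl fun s _ => by ring
    have h3 : ∑ s ∈ Ω, κ s ^ 4 ≤ 4 * m := by
      have := sum_le_of_decay hδ (by positivity : (0 : ℝ) ≤ 1 / (2 * n)) hpack x
        (F := fun s => κ s ^ 4) (fun s _ => pow_le_one₀ (hκ0 s) (hκ1 s)) fun s _ hxs => by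
          have := norm_dirichletPolynomial_eval_le hn hxs
          rw [← div_div] at this
          exact pow_le_pow_left₀ (hκ0 s) this 4
      have h4 : 4 * (m : ℝ) * (1 / (2 * n) / δ) ^ 4 ≤ 4 * m * (1 / 2) := by gcongr
      linarith
    have h5 : ∑ s ∈ Ω, ‖v s‖ ^ 2 * κ s ^ 4 ≤ ∑ s ∈ Ω, ‖v s‖ ^ 2 * κ s ^ 2 :=
      Finset.sum_le_sum fun s _ => mul_le_mul_of_nonneg_left
        (pow_le_pow_of_le_one (hκ0 s) (hκ1 s) (by norm_num)) (by positivity)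
    calc _ ≤ (B * ∑ s ∈ Ω, ‖v s‖ * κ s ^ 4) ^ 2 := by gcongr
      _ = B ^ 2 * (∑ s ∈ Ω, ‖v s‖ * κ s ^ 4) ^ 2 := by ring
      _ ≤ B ^ 2 * ((∑ s ∈ Ω, ‖v s‖ ^ 2 * κ s ^ 2) * (4 * m)) := by
        refine mul_le_mul_of_nonneg_left (h2.trans ?_) (by positivity)
        refine mul_le_mul h5 h3 (Finset.sum_nonneg fun s _ => by positivity)
          (Finset.sum_nonneg fun s _ => by positivity)
      _ = _ := by ring
  have hsum : N * ∑ k ∈ Finset.range N, ‖q.coeff k‖ ^ 2 ≤ 4 * m * B ^ 2 * (V * (N / n)) := by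
    rw [← Polynomial.sum_norm_sq_eval_roots hω hqdeg]
    refine (Finset.sum_le_sum hpt).trans_eq ?_
    rw [← Finset.mul_sum, Finset.sum_comm, hV, Finset.sum_mul]
    congr 1
    refine Finset.sum_congr rfl fun s _ => ?_
    rw [← Finset.mul_sum, sum_norm_sq_dirichletPolynomial_eval_roots hω hn hnN]
  refine le_of_mul_le_mul_left ?_ hN'
  calc (N : ℝ) * (n * ∑ k ∈ Finset.range N, ‖q.coeff k‖ ^ 2)
      = n * (N * ∑ k ∈ Finset.range N, ‖q.coeff k‖ ^ 2) := by ring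
    _ ≤ n * (4 * m * B ^ 2 * (V * (N / n))) := by gcongr
    _ = _ := by field_simp

theorem norm_sq_vandermonde_lower_bound {Ω : Finset UnitAddCircle} {N n m : ℕ} {δ B : ℝ}
    (hn : 0 < n) (hnN : (m + 3) * n ≤ N) (cl : UnitAddCircle → Finset UnitAddCircle)
    (hmem : ∀ t ∈ Ω, t ∈ cl t) (hcard : ∀ t ∈ Ω, (cl t).card ≤ m)
    (hclose : ∀ t ∈ Ω, ∀ s ∈ cl t, n * dist t s ≤ 1 / 2) (hδ : 0 < δ)
    (hfar : ∀ t ∈ Ω, ∀ s ∈ Ω, s ∉ cl t → δ ≤ dist t s) (hB0 : 0 ≤ B)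
    (hB : ∀ t ∈ Ω, ∏ s ∈ (cl t).filter (· ≠ t), 1 / (2 * n * dist t s) ≤ B)
    (hsmall : B * (4 * m * (1 / (2 * n) / δ) ^ 4) ≤ 1 / 2)
    (hδn : (1 / (2 * n) / δ) ^ 4 ≤ 1 / 2) (v : UnitAddCircle → ℂ) :
    n * ∑ t ∈ Ω, ‖v t‖ ^ 2 ≤ 16 * m * B ^ 2 * ∑ k ∈ Finset.range N,
      ‖∑ t ∈ Ω, (starRingEnd ℂ) ((AddCircle.toCircle t : ℂ) ^ k) * v t‖ ^ 2 := by
  have hn' : (0 : ℝ) < n := by exact_mod_cast hn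
  have hnN1 : n ≤ N := le_trans (by nlinarith) hnN
  -- Nodes at mutual distance below `δ` all lie in the cluster of any one of them.
  have hpack : ∀ T ⊆ Ω, (∀ s ∈ T, ∀ s' ∈ T, dist s s' < δ) → T.card ≤ m := by
    intro T hT hd
    obtain rfl | ⟨t, ht⟩ := T.eq_empty_or_nonempty
    · simp
    refine (Finset.card_le_card fun s hs => ?_).trans (hcard t (hT ht))
    by_contra h
    exact absurd (hd t ht s hs) (not_lt.2 (hfar t (hT ht) s (hT hs) h))
  have hdeg : ∀ t ∈ Ω, (localizedPolynomial n (cl t) t).natDegree < N := fun t ht =>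
    localizedPolynomial_natDegree_lt hn hnN (hmem t ht) (hcard t ht)
  have h1 := sum_eval_localizedPolynomial_bound hn cl hclose hδ hfar hB0 hB hpack hsmall v
  have h2 := sum_norm_sq_coeff_localizedPolynomial_le hn hnN1 cl hdeg hclose hδ hB hpack hδn v
  set V := ∑ t ∈ Ω, ‖v t‖ ^ 2 with hV
  set h : ℕ → ℂ := fun k => ∑ t ∈ Ω, (starRingEnd ℂ) ((AddCircle.toCircle t : ℂ) ^ k) * v t with hh
  set q := ∑ s ∈ Ω, Polynomial.C (v s) * localizedPolynomial n (cl s) s with hq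
  have heval : ∑ t ∈ Ω, (starRingEnd ℂ) (v t) *
      ∑ s ∈ Ω, v s * (localizedPolynomial n (cl s) s).eval (AddCircle.toCircle t : ℂ) =
      ∑ k ∈ Finset.range N, (starRingEnd ℂ) (h k) * q.coeff k := by
    have hqdeg : q.natDegree < N := by
      refine lt_of_le_of_lt (Polynomial.natDegree_sum_le_of_forall_le _ _ (n := N - 1)
        fun s hs => ?_) (by have := hn.trans_le hnN1; omega)
      have := Polynomial.natDegree_C_mul_le (v s) (localizedPolynomial n (cl s) s)
      have := hdeg s hs
      omega
    have he : ∀ t : UnitAddCircle, ∑ s ∈ Ω, v s * (localizedPolynomial n (cl s) s).eval (AddCircle.toCircle t : ℂ) =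
        ∑ k ∈ Finset.range N, q.coeff k * (AddCircle.toCircle t : ℂ) ^ k := by
      intro t
      rw [← Polynomial.eval_eq_sum_range' hqdeg, hq, Polynomial.eval_finsetSum]
      simp
    simp only [he, hh, map_sum, map_mul, Complex.conj_conj, Finset.sum_mul, Finset.mul_sum]
    rw [Finset.sum_comm]
    exact Finset.sum_congr rfl fun k _ => Finset.sum_congr rfl fun t _ => by ring
  rw [heval] at h1
  have hV0 : 0 ≤ V := Finset.sum_nonneg fun _ _ => by positivity
  have h3 : ‖∑ k ∈ Finset.range N, (starRingEnd ℂ) (h k) * q.coeff k‖ ^ 2 ≤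
      (∑ k ∈ Finset.range N, ‖h k‖ ^ 2) * ∑ k ∈ Finset.range N, ‖q.coeff k‖ ^ 2 := by
    refine le_trans ?_ (Finset.sum_mul_sq_le_sq_mul_sq _ (fun k => ‖h k‖) fun k => ‖q.coeff k‖)
    gcongr
    refine (norm_sum_le _ _).trans_eq (Finset.sum_congr rfl fun k _ => ?_)
    rw [norm_mul, RCLike.norm_conj]
  have h4 : (V / 2) ^ 2 ≤
      (∑ k ∈ Finset.range N, ‖h k‖ ^ 2) * ∑ k ∈ Finset.range N, ‖q.coeff k‖ ^ 2 :=
    le_trans (by gcongr) h3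
  set H := ∑ k ∈ Finset.range N, ‖h k‖ ^ 2 with hH
  have hH0 : 0 ≤ H := Finset.sum_nonneg fun _ _ => by positivity
  obtain hV1 | hV1 := hV0.eq_or_lt
  · rw [← hV1, mul_zero]; positivity
  refine le_of_mul_le_mul_right ?_ hV1
  have h5 : n * (V / 2) ^ 2 ≤ H * (4 * m * B ^ 2 * V) := by
    calc _ ≤ n * (H * ∑ k ∈ Finset.range N, ‖q.coeff k‖ ^ 2) := by gcongr
      _ = H * (n * ∑ k ∈ Finset.range N, ‖q.coeff k‖ ^ 2) := by ring
      _ ≤ _ := by gcongr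
  linarith

/-! ### Products of separated real numbers -/

/-- The integers `⌊f i / τ⌋₊` are distinct and lie between `1` and `⌊b / τ⌋₊`. -/
theorem card_mul_le_of_separated {ι : Type*} {F : Finset ι} {f : ι → ℝ} {τ b : ℝ} (hτ : 0 < τ)
    (h1 : ∀ i ∈ F, τ ≤ f i) (h2 : ∀ i ∈ F, ∀ j ∈ F, i ≠ j → τ ≤ |f i - f j|)
    (hb0 : 0 ≤ b) (hb : ∀ i ∈ F, f i ≤ b) : F.card * τ ≤ b := by
  have hcard : F.card ≤ (Finset.Icc 1 ⌊b / τ⌋₊).card := by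
    refine Finset.card_le_card_of_injOn (fun i => ⌊f i / τ⌋₊) (fun i hi => ?_) fun i hi j hj hij => ?_
    · have h3 := hb i hi
      have h4 := h1 i hi
      simp only [Finset.coe_Icc, Set.mem_Icc]
      refine ⟨?_, Nat.floor_le_floor (by gcongr)⟩
      rwa [Nat.one_le_floor_iff, one_le_div hτ]
    · by_contra hne
      have h3 := h2 i hi j hj hne
      have hi0 := hτ.le.trans (h1 i hi)
      have hj0 := hτ.le.trans (h1 j hj)
      have a1 := Nat.floor_le (div_nonneg hi0 hτ.le)
      have a2 := Nat.lt_floor_add_one (f i / τ)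
      have a3 := Nat.floor_le (div_nonneg hj0 hτ.le)
      have a4 := Nat.lt_floor_add_one (f j / τ)
      simp only at hij
      rw [hij] at a1 a2
      rw [le_div_iff₀ hτ] at a1 a3
      rw [div_lt_iff₀ hτ] at a2 a4
      refine absurd h3 (not_le.2 ?_)
      rw [abs_lt]
      constructor <;> linarith
  rw [Nat.card_Icc, Nat.add_sub_cancel] at hcard
  have := Nat.floor_le (div_nonneg hb0 hτ.le)
  rw [← le_div_iff₀ hτ]
  exact le_trans (by exact_mod_cast hcard) this

/-- In increasing order the `k`-th value is at least `k * τ`; the induction removes the largest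
value. -/
theorem pow_mul_factorial_le_prod {ι : Type*} {F : Finset ι} {f : ι → ℝ} {τ : ℝ} (hτ : 0 < τ)
    (h1 : ∀ i ∈ F, τ ≤ f i) (h2 : ∀ i ∈ F, ∀ j ∈ F, i ≠ j → τ ≤ |f i - f j|) :
    τ ^ F.card * F.card.factorial ≤ ∏ i ∈ F, f i := by
  classical
  induction F using Finset.induction_on_max_value f with
  | empty => simp
  | insert a s ha hmax ih =>
    have ih' := ih (fun i hi => h1 i (Finset.mem_insert_of_mem hi))
      fun i hi j hj => h2 i (Finset.mem_insert_of_mem hi) j (Finset.mem_insert_of_mem hj)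
    have hfa := h1 a (Finset.mem_insert_self a s)
    have h3 : ((insert a s).card : ℝ) * τ ≤ f a := by
      refine card_mul_le_of_separated hτ h1 h2 (hτ.le.trans hfa) fun i hi => ?_
      obtain rfl | hi := Finset.mem_insert.1 hi
      · exact le_rfl
      · exact hmax i hi
    rw [Finset.card_insert_of_notMem ha] at h3 ⊢
    rw [Finset.prod_insert ha, Nat.factorial_succ, pow_succ]
    push_cast at h3 ⊢
    calc _ = ((s.card : ℝ) + 1) * τ * (τ ^ s.card * s.card.factorial) := by ring
      _ ≤ _ := mul_le_mul h3 ih' (by positivity) (hτ.le.trans hfa)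

/-- Positive and nonpositive values are treated separately; the factor `2 ^ F.card` bounds the
binomial coefficient comparing the factorial of the total with the product of the two factorials. -/
theorem pow_mul_factorial_le_two_pow_mul_prod_abs {ι : Type*} {F : Finset ι} {f : ι → ℝ} {τ : ℝ}
    (hτ : 0 < τ) (h1 : ∀ i ∈ F, τ ≤ |f i|) (h2 : ∀ i ∈ F, ∀ j ∈ F, i ≠ j → τ ≤ |f i - f j|) :
    τ ^ F.card * F.card.factorial ≤ 2 ^ F.card * ∏ i ∈ F, |f i| := by
  classical
  set P := F.filter fun i => 0 < f i with hP
  set Q := F.filter fun i => ¬ 0 < f i with hQ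
  have hPF : P ⊆ F := Finset.filter_subset _ _
  have hQF : Q ⊆ F := Finset.filter_subset _ _
  have hc : P.card + Q.card = F.card := Finset.card_filter_add_card_filter_not _
  have hp := pow_mul_factorial_le_prod (F := P) (f := fun i => |f i|) hτ
    (fun i hi => h1 i (hPF hi)) fun i hi j hj hij => by
      rw [abs_of_pos (Finset.mem_filter.1 hi).2, abs_of_pos (Finset.mem_filter.1 hj).2]
      exact h2 i (hPF hi) j (hPF hj) hij
  have hq := pow_mul_factorial_le_prod (F := Q) (f := fun i => |f i|) hτ
    (fun i hi => h1 i (hQF hi)) fun i hi j hj hij => by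
      rw [abs_of_nonpos (not_lt.1 (Finset.mem_filter.1 hi).2),
        abs_of_nonpos (not_lt.1 (Finset.mem_filter.1 hj).2), neg_sub_neg, abs_sub_comm]
      exact h2 i (hQF hi) j (hQF hj) hij
  have hf : (F.card.factorial : ℝ) ≤ 2 ^ F.card * (P.card.factorial * Q.card.factorial) := by
    rw [← hc, ← Nat.add_choose_mul_factorial_mul_factorial, mul_assoc]
    have := Nat.choose_le_two_pow (P.card + Q.card) Q.card
    push_cast
    gcongr
    exact_mod_cast this
  rw [← Finset.prod_filter_mul_prod_filter_not F (fun i => 0 < f i)]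
  calc τ ^ F.card * F.card.factorial
      ≤ τ ^ F.card * (2 ^ F.card * (P.card.factorial * Q.card.factorial)) := by gcongr
    _ = 2 ^ F.card * ((τ ^ P.card * P.card.factorial) * (τ ^ Q.card * Q.card.factorial)) := by
        rw [← hc]; ring
    _ ≤ _ := by gcongr

/-! ### Separation threshold, cluster complexity and clusters -/

/-- The separation threshold in `admissibleConfigurations`, as a function of the complexity. -/
noncomputable def separationThreshold (m : ℕ) (C : ℝ) : ℝ :=
  2 * m * √(2 * √2 * (m : ℝ) ^ m * (Real.pi ^ 2 / 6) * C)

theorem separationThreshold_nonneg (m : ℕ) (C : ℝ) : 0 ≤ separationThreshold m C := by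
  unfold separationThreshold; positivity

theorem separationThreshold_mono (m : ℕ) : Monotone (separationThreshold m) := by
  intro C C' h
  unfold separationThreshold
  gcongr

/-- The lower bound needs only this much of the explicit threshold: its square dominates the
complexity. -/
theorem le_sq_separationThreshold {m : ℕ} (hm : 2 ≤ m) {C : ℝ} (hC : 0 ≤ C) :
    C ≤ separationThreshold m C ^ 2 := by
  unfold separationThreshold
  have hpi := Real.pi_gt_three
  have h2 : (1 : ℝ) ≤ √2 := by rw [Real.one_le_sqrt]; norm_num
  have hm' : (1 : ℝ) ≤ m := by exact_mod_cast (by omega : 1 ≤ m)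
  have hm2 : (1 : ℝ) ≤ (m : ℝ) ^ m := one_le_pow₀ hm'
  have hp : (1 : ℝ) ≤ Real.pi ^ 2 / 6 := by nlinarith
  rw [mul_pow, Real.sq_sqrt (by positivity)]
  have h3 : (1 : ℝ) ≤ (2 * m) ^ 2 * (2 * √2 * (m : ℝ) ^ m * (Real.pi ^ 2 / 6)) := by
    have e1 : (1 : ℝ) ≤ (2 * m) ^ 2 := one_le_pow₀ (by linarith)
    have e2 : (1 : ℝ) ≤ 2 * √2 := by linarith
    exact one_le_mul_of_one_le_of_one_le e1 (one_le_mul_of_one_le_of_one_le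
      (one_le_mul_of_one_le_of_one_le e2 hm2) hp)
  calc C = 1 * C := (one_mul C).symm
    _ ≤ _ := by rw [← mul_assoc]; gcongr

theorem le_clusterSeparation_iff {N : ℕ} {L : ℕ} {Λ : Fin L → Finset UnitAddCircle} {r : ℝ}
    (hr : 0 < r) : ENNReal.ofReal r ≤ clusterSeparation N Λ ↔
      ∀ l l', l ≠ l' → ∀ t ∈ Λ l, ∀ t' ∈ Λ l', r ≤ N * dist t t' := by
  simp only [clusterSeparation, le_iInf_iff]
  refine forall₅_congr fun l l' _ t _ => forall₂_congr fun t' _ => ?_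
  constructor
  · intro h
    by_contra! h'
    rw [ENNReal.ofReal_le_ofReal_iff'] at h
    rcases h with h | h <;> linarith
  · exact ENNReal.ofReal_le_ofReal

/-- Truncating at `1` removes the distance condition: far nodes give a quotient at most `1`, and `t`
itself gives `1 / 0 = 0`. The new form has no jumps at distance `1 / N`. -/
theorem clusterComplexity_prod_eq {N : ℕ} (hN : 0 < N) (Ω : Finset UnitAddCircle)
    (t : UnitAddCircle) [DecidablePred fun t' => 0 < dist t t' ∧ dist t t' ≤ 1 / N] :
    ∏ t' ∈ Ω with 0 < dist t t' ∧ dist t t' ≤ 1 / N, 1 / (N * dist t t') =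
      ∏ t' ∈ Ω, max 1 (1 / (N * dist t t')) := by
  have hN' : (0 : ℝ) < N := by exact_mod_cast hN
  rw [Finset.prod_filter]
  refine Finset.prod_congr rfl fun t' _ => ?_
  obtain h0 | h0 := (dist_nonneg (x := t) (y := t')).eq_or_lt
  · simp [← h0]
  have hpos : 0 < N * dist t t' := by positivity
  split_ifs with h
  · rw [max_eq_right]
    rw [one_le_div hpos, mul_comm, ← le_div_iff₀ hN']
    exact h.2
  · have h' : 1 / N < dist t t' := not_le.1 fun h' => h ⟨h0, h'⟩
    rw [max_eq_left]
    rw [div_le_one hpos, mul_comm, ← div_le_iff₀ hN']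
    exact h'.le

theorem clusterComplexity_eq {N : ℕ} (hN : 0 < N) (Ω : Finset UnitAddCircle) :
    clusterComplexity N Ω = ⨆ t : Ω, ∏ t' ∈ Ω, max 1 (1 / (N * dist (t : UnitAddCircle) t')) := by
  unfold clusterComplexity
  exact iSup_congr fun t => clusterComplexity_prod_eq hN Ω t

theorem prod_le_clusterComplexity {N : ℕ} (hN : 0 < N) {Ω : Finset UnitAddCircle}
    {t : UnitAddCircle} (ht : t ∈ Ω) :
    ∏ t' ∈ Ω, max 1 (1 / (N * dist t t')) ≤ clusterComplexity N Ω := by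
  rw [clusterComplexity_eq hN]
  exact le_ciSup (f := fun t : Ω => ∏ t' ∈ Ω, max 1 (1 / (N * dist (t : UnitAddCircle) t')))
    (Set.finite_range _).bddAbove ⟨t, ht⟩

theorem exists_clusterComplexity_eq_prod {N : ℕ} (hN : 0 < N) {Ω : Finset UnitAddCircle}
    (hΩ : Ω.Nonempty) :
    ∃ t ∈ Ω, clusterComplexity N Ω = ∏ t' ∈ Ω, max 1 (1 / (N * dist t t')) := by
  rw [clusterComplexity_eq hN]
  have : Nonempty Ω := hΩ.to_subtype
  obtain ⟨t, ht⟩ := exists_eq_ciSup_of_finite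
    (f := fun t : Ω => ∏ t' ∈ Ω, max 1 (1 / (N * dist (t : UnitAddCircle) t')))
  exact ⟨t, t.2, ht.symm⟩

theorem minimalSeparation_eq_iff {N : ℕ} (hN : 0 < N) {Ω : Finset UnitAddCircle} {τ : ℝ}
    (hτ : 0 < τ) : minimalSeparation N Ω = τ ↔
      (∀ t ∈ Ω, ∀ t' ∈ Ω, t ≠ t' → τ ≤ N * dist t t') ∧
        ∃ t ∈ Ω, ∃ t' ∈ Ω, t ≠ t' ∧ N * dist t t' = τ := by
  classical
  have hN' : (0 : ℝ) < N := by exact_mod_cast hN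
  unfold minimalSeparation
  rw [Finset.coe_infsep]
  constructor
  · intro h
    split_ifs at h with hs
    · refine ⟨fun t ht t' ht' hne => ?_, ?_⟩
      · rw [← h]
        have := Finset.inf'_le (Function.uncurry dist) (Finset.mem_offDiag.2 ⟨ht, ht', hne⟩ :
          (t, t') ∈ Ω.offDiag)
        exact mul_le_mul_of_nonneg_left this hN'.le
      · obtain ⟨⟨t, t'⟩, hp, he⟩ := Finset.exists_mem_eq_inf' hs (Function.uncurry dist)
        rw [Finset.mem_offDiag] at hp
        rw [he] at h
        exact ⟨t, hp.1, t', hp.2.1, hp.2.2, h⟩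
    · rw [mul_zero] at h; exact absurd h hτ.ne
  · rintro ⟨h1, t, ht, t', ht', hne, h⟩
    have hmem : (t, t') ∈ Ω.offDiag := Finset.mem_offDiag.2 ⟨ht, ht', hne⟩
    rw [dif_pos ⟨_, hmem⟩]
    refine le_antisymm (h ▸ mul_le_mul_of_nonneg_left (Finset.inf'_le _ hmem) hN'.le) ?_
    rw [← div_le_iff₀' hN']
    refine Finset.le_inf' _ _ fun p hp => ?_
    rw [Finset.mem_offDiag] at hp
    rw [div_le_iff₀' hN']
    exact h1 _ hp.1 _ hp.2.1 hp.2.2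

theorem Finset.one_le_prod_max {ι : Type*} (F : Finset ι) (f : ι → ℝ) :
    1 ≤ ∏ i ∈ F, max 1 (f i) :=
  Finset.prod_induction _ (fun x => 1 ≤ x) (fun _ _ => one_le_mul_of_one_le_of_one_le) le_rfl
    fun _ _ => le_max_left _ _

theorem one_le_clusterComplexity {N : ℕ} (hN : 0 < N) {Ω : Finset UnitAddCircle}
    (hΩ : Ω.Nonempty) : 1 ≤ clusterComplexity N Ω := by
  obtain ⟨t, ht⟩ := hΩ
  refine le_trans ?_ (prod_le_clusterComplexity hN ht)
  exact Finset.one_le_prod_max _ _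

theorem one_div_le_clusterComplexity {N : ℕ} (hN : 0 < N) {Ω : Finset UnitAddCircle} {τ : ℝ}
    (hτ : 0 < τ) (h : minimalSeparation N Ω = τ) : 1 / τ ≤ clusterComplexity N Ω := by
  classical
  obtain ⟨-, t, ht, t', ht', -, h⟩ := (minimalSeparation_eq_iff hN hτ).1 h
  refine le_trans ?_ (prod_le_clusterComplexity hN ht)
  rw [← Finset.mul_prod_erase Ω _ ht', h]
  calc 1 / τ ≤ max 1 (1 / τ) * 1 := by rw [mul_one]; exact le_max_right _ _
    _ ≤ _ := by
      gcongr
      exact Finset.one_le_prod_max _ _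

/-- An arc of length at most `1 / 2` is isometric to an interval, so packing on the line applies to
a cluster. -/
theorem IsCluster.exists_lift {N : ℕ} (hN : 2 ≤ N) {K : Finset UnitAddCircle}
    (hK : IsCluster N K) : ∃ f : UnitAddCircle → ℝ, ∀ s ∈ K, ∀ s' ∈ K,
      dist s s' = |f s - f s'| ∧ dist s s' ≤ 1 / N := by
  obtain ⟨a, ha⟩ := hK
  choose! f h1 h2 h3 using ha
  refine ⟨f, fun s hs s' hs' => ?_⟩
  have h4 : |f s - f s'| ≤ 1 / N := by
    have := h1 s hs; have := h2 s hs; have := h1 s' hs'; have := h2 s' hs'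
    rw [abs_le]; constructor <;> linarith
  have h5 : (1 : ℝ) / N ≤ 1 / 2 := by
    have : (2 : ℝ) ≤ N := by exact_mod_cast hN
    gcongr
  have h6 : dist s s' = |f s - f s'| := by
    rw [dist_eq_norm, ← UnitAddCircle.norm_coe_of_abs_le (h4.trans h5), AddCircle.coe_sub,
      h3 s hs, h3 s' hs']
  exact ⟨h6, h6 ▸ h4⟩

theorem exists_clusterMap {N m : ℕ} {τ : ℝ} (hN : 2 ≤ N) (hm : 2 ≤ m) {Ω : Finset UnitAddCircle}
    (hΩ : Ω ∈ admissibleConfigurations N m τ) :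
    ∃ cl : UnitAddCircle → Finset UnitAddCircle, ∀ t ∈ Ω, t ∈ cl t ∧ cl t ⊆ Ω ∧ (cl t).card ≤ m ∧
      IsCluster N (cl t) ∧ ∀ s ∈ Ω, s ∉ cl t →
        separationThreshold m (clusterComplexity N Ω) ≤ N * dist t s := by
  obtain ⟨-, -, L, Λ, hΛ, hgr, hsep⟩ := hΩ
  have hU : ∀ t, t ∈ Ω ↔ ∃ l, t ∈ Λ l := fun t => by
    rw [← Finset.mem_coe, ← hΛ.iUnion_eq]; simp
  refine ⟨fun t => if h : ∃ l, t ∈ Λ l then Λ h.choose else ∅, fun t ht => ?_⟩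
  have ht' := (hU t).1 ht
  simp only [dif_pos ht']
  refine ⟨ht'.choose_spec, fun s hs => (hU s).2 ⟨_, hs⟩, hgr.2 ⟨_, rfl⟩, hΛ.isCluster _, ?_⟩
  intro s hs hns
  obtain ⟨l', hl'⟩ := (hU s).1 hs
  have hpos : 0 < separationThreshold m (clusterComplexity N Ω) := by
    have h1 := one_le_clusterComplexity (by omega : 0 < N) ⟨t, ht⟩
    have h2 := le_sq_separationThreshold hm (zero_le_one.trans h1)
    refine (separationThreshold_nonneg _ _).lt_of_ne fun h => ?_
    rw [← h] at h2
    linarith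
  refine (le_clusterSeparation_iff hpos).1 hsep _ l' (fun h : ht'.choose = l' => hns (by rw [h]; exact hl')) t ht'.choose_spec s hl'

/-! ### The lower bound for admissible configurations -/

theorem sigmaMin_vandermonde_attained (N : ℕ) {Ω : Finset UnitAddCircle} (hΩ : Ω.Nonempty) :
    ∃ v : UnitAddCircle → ℂ, ∑ t ∈ Ω, ‖v t‖ ^ 2 = 1 ∧
      sigmaMin (vandermondeMatrix N Ω) ^ 2 = ∑ k ∈ Finset.range N,
        ‖∑ t ∈ Ω, (starRingEnd ℂ) ((AddCircle.toCircle t : ℂ) ^ k) * v t‖ ^ 2 := by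
  classical
  have : Nonempty Ω := hΩ.to_subtype
  obtain ⟨v, hv, h⟩ := (sigmaMin_isLeast (vandermondeMatrix N Ω)).1
  refine ⟨fun t => if ht : t ∈ Ω then v ⟨t, ht⟩ else 0, ?_, ?_⟩
  · have h1 : ‖v‖ ^ 2 = 1 := by rw [hv, one_pow]
    rw [← Finset.sum_coe_sort]
    refine Eq.trans ?_ h1
    rw [EuclideanSpace.norm_sq_eq]
    exact Finset.sum_congr rfl fun t _ => by simp
  · rw [h, EuclideanSpace.norm_sq_eq, ← Fin.sum_univ_eq_sum_range (fun k =>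
      ‖∑ t ∈ Ω, (starRingEnd ℂ) ((AddCircle.toCircle t : ℂ) ^ k) *
        (if ht : t ∈ Ω then v ⟨t, ht⟩ else 0)‖ ^ 2)]
    refine Finset.sum_congr rfl fun k _ => ?_
    rw [← Finset.sum_coe_sort]
    simp [Matrix.mulVec, dotProduct, vandermondeMatrix]

theorem sigmaMin_nonneg {m n : Type*} [Fintype m] [Fintype n] (A : Matrix m n ℂ) :
    0 ≤ sigmaMin A :=
  Real.sInf_nonneg (by rintro _ ⟨v, -, rfl⟩; exact norm_nonneg _)

/-- Each factor is `N / (2 * n) ≤ m + 3` over a normalized distance. Packing puts a factorial in the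
denominator, and `(m + 3) ^ k / k! ≤ exp (m + 3)` is only exponential in `m`. -/
theorem prod_one_div_two_mul_dist_le {N m n : ℕ} {τ : ℝ} (hn : 0 < n) (hN : 2 ≤ N)
    (hNn : (N : ℝ) ≤ 2 * n * (m + 3)) (hτ : 0 < τ) (hτ1 : τ ≤ 1) {K : Finset UnitAddCircle}
    {t : UnitAddCircle} (ht : t ∈ K) (hKm : K.card ≤ m) (hK : IsCluster N K)
    (hsep : ∀ s ∈ K, ∀ s' ∈ K, s ≠ s' → τ ≤ N * dist s s') :
    ∏ s ∈ K.filter (· ≠ t), 1 / (2 * n * dist t s) ≤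
      (2 / τ) ^ (m - 1) * Real.exp (m + 3) := by
  classical
  obtain ⟨f, hf⟩ := hK.exists_lift hN
  have hn' : (0 : ℝ) < n := by exact_mod_cast hn
  have hN' : (0 : ℝ) < N := by exact_mod_cast (by omega : 0 < N)
  set F := K.filter (· ≠ t) with hF
  have hFK : F ⊆ K := Finset.filter_subset _ _
  have hFcard : F.card ≤ m - 1 := by
    have h1 : F = K.erase t := by ext s; simp [hF, and_comm]
    rw [h1, Finset.card_erase_of_mem ht]
    omega
  have hNd : ∀ s ∈ K, ∀ s' ∈ K, N * dist s s' = |N * f s - N * f s'| := fun s hs s' hs' => by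
    rw [(hf s hs s' hs').1, ← mul_sub, abs_mul, Nat.abs_cast]
  have hpack := pow_mul_factorial_le_two_pow_mul_prod_abs (F := F)
    (f := fun s => N * f t - N * f s) hτ
    (fun s hs => by
      rw [← hNd t ht s (hFK hs)]
      exact hsep t ht s (hFK hs) (Ne.symm (Finset.mem_filter.1 hs).2))
    fun s hs s' hs' hne => by
      have := hsep s (hFK hs) s' (hFK hs') hne
      rw [hNd s (hFK hs) s' (hFK hs'), abs_sub_comm] at this
      simpa using this
  have hprod : ∏ s ∈ F, 1 / (2 * n * dist t s) =
      (N / (2 * n)) ^ F.card / ∏ s ∈ F, |N * f t - N * f s| := by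
    rw [← Finset.prod_const, ← Finset.prod_div_distrib]
    refine Finset.prod_congr rfl fun s hs => ?_
    rw [← hNd t ht s (hFK hs), div_div, mul_left_comm, div_mul_cancel_left₀ hN'.ne', one_div]
  have hpos : 0 < τ ^ F.card * (F.card.factorial : ℝ) := by positivity
  have hp : 0 < ∏ s ∈ F, |N * f t - N * f s| := by
    by_contra h
    have := mul_nonpos_of_nonneg_of_nonpos (by positivity : (0 : ℝ) ≤ 2 ^ F.card) (not_lt.1 h)
    linarith
  have hratio : (N : ℝ) / (2 * n) ≤ m + 3 := by
    rw [div_le_iff₀ (by positivity)]; linarith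
  rw [hprod, div_le_iff₀ hp]
  have hexp := Real.pow_div_factorial_le_exp (x := (m : ℝ) + 3) (by positivity) F.card
  have h2τ : 1 ≤ 2 / τ := by rw [one_le_div hτ]; linarith
  calc (N / (2 * n) : ℝ) ^ F.card ≤ ((m : ℝ) + 3) ^ F.card := by gcongr
    _ = (2 / τ) ^ F.card * (((m : ℝ) + 3) ^ F.card / F.card.factorial) *
        ((τ ^ F.card * F.card.factorial) / 2 ^ F.card) := by
        rw [div_pow]
        field_simp
    _ ≤ (2 / τ) ^ (m - 1) * Real.exp (m + 3) * ∏ s ∈ F, |N * f t - N * f s| := by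
        have h3 : (τ ^ F.card * F.card.factorial) / 2 ^ F.card ≤
            ∏ s ∈ F, |N * f t - N * f s| := by
          rw [div_le_iff₀' (by positivity)]; exact hpack
        have h4 : (2 / τ) ^ F.card ≤ (2 / τ) ^ (m - 1) := pow_le_pow_right₀ h2τ hFcard
        gcongr

theorem prod_one_div_two_mul_dist_le_clusterComplexity {N m n : ℕ} (hn : 0 < n) (hN : 0 < N)
    (hNn : (N : ℝ) ≤ 2 * n * (m + 3)) {Ω K : Finset UnitAddCircle} (hKΩ : K ⊆ Ω)
    {t : UnitAddCircle} (ht : t ∈ Ω) (hKm : K.card ≤ m) :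
    ∏ s ∈ K.filter (· ≠ t), 1 / (2 * n * dist t s) ≤
      (m + 3) ^ m * clusterComplexity N Ω := by
  classical
  have hn' : (0 : ℝ) < n := by exact_mod_cast hn
  have hN' : (0 : ℝ) < N := by exact_mod_cast hN
  set F := K.filter (· ≠ t) with hF
  have hFK : F ⊆ K := Finset.filter_subset _ _
  have hratio : (N : ℝ) / (2 * n) ≤ m + 3 := by
    rw [div_le_iff₀ (by positivity)]; linarith
  have hprod : ∏ s ∈ F, 1 / (2 * n * dist t s) ≤
      (N / (2 * n)) ^ F.card * ∏ s ∈ F, max 1 (1 / (N * dist t s)) := by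
    rw [← Finset.prod_const, ← Finset.prod_mul_distrib]
    refine Finset.prod_le_prod (fun s _ => by positivity) fun s _ => ?_
    calc 1 / (2 * n * dist t s) = N / (2 * n) * (1 / (N * dist t s)) := by
          rw [div_mul_div_comm, mul_one, mul_left_comm, div_mul_cancel_left₀ hN'.ne', one_div]
      _ ≤ _ := by gcongr; exact le_max_right _ _
  have h1 : ∏ s ∈ F, max 1 (1 / (N * dist t s)) ≤ clusterComplexity N Ω := by
    refine le_trans ?_ (prod_le_clusterComplexity hN ht)
    rw [← Finset.prod_sdiff (hFK.trans hKΩ)]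
    refine le_mul_of_one_le_left ?_ (Finset.one_le_prod_max _ _)
    exact zero_le_one.trans (Finset.one_le_prod_max _ _)
  refine hprod.trans (mul_le_mul ?_ h1 (zero_le_one.trans (Finset.one_le_prod_max _ _))
    (by positivity))
  calc ((N : ℝ) / (2 * n)) ^ F.card ≤ ((m : ℝ) + 3) ^ F.card := by gcongr
    _ ≤ ((m : ℝ) + 3) ^ m :=
      pow_le_pow_right₀ (by linarith [m.cast_nonneg (α := ℝ)])
        ((Finset.card_le_card hFK).trans hKm)

theorem thirty_two_mul_le_pow {m : ℕ} (hm : 2 ≤ m) :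
    32 * (m : ℝ) * (m + 3) ≤ (20 ^ (m - 1)) ^ 2 := by
  obtain ⟨j, rfl⟩ := Nat.exists_eq_add_of_le' hm
  simp only [show j + 2 - 1 = j + 1 by omega]
  induction j with
  | zero => norm_num
  | succ j ih =>
    have h := ih (by omega)
    have hj : (0 : ℝ) ≤ j := j.cast_nonneg
    push_cast at h ⊢
    rw [pow_succ (20 : ℝ) (j + 1), mul_pow]
    nlinarith

theorem sqrt_mul_pow_le_sigmaMin {N m : ℕ} {τ : ℝ} (hm : 2 ≤ m) (hN : m + 3 ≤ N) (hτ : 0 < τ)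
    (hτ0 : τ ≤ 1 / (8 * m * (m + 3) ^ (m + 4))) {Ω : Finset UnitAddCircle}
    (hΩ : Ω ∈ admissibleConfigurations N m τ) :
    √(N : ℝ) * (1 / 10000 * τ) ^ (m - 1) ≤ sigmaMin (vandermondeMatrix N Ω) := by
  have hN2 : 2 ≤ N := by omega
  have hN0 : 0 < N := by omega
  have hN' : (0 : ℝ) < N := by exact_mod_cast hN0
  have hm' : (2 : ℝ) ≤ m := by exact_mod_cast hm
  have hsepN := (minimalSeparation_eq_iff hN0 hτ).1 hΩ.2.1
  have hne : Ω.Nonempty := by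
    obtain ⟨t, ht, -⟩ := hsepN.2
    exact ⟨t, ht⟩
  have hCτ := one_div_le_clusterComplexity hN0 hτ hΩ.2.1
  have hC1 := one_le_clusterComplexity hN0 hne
  obtain ⟨cl, hcl⟩ := exists_clusterMap hN2 hm hΩ
  set C := clusterComplexity N Ω with hC
  have hCR := le_sq_separationThreshold hm (zero_le_one.trans hC1)
  have hR0 := separationThreshold_nonneg m C
  set R := separationThreshold m C with hR
  have hRpos : 0 < R := hR0.lt_of_ne fun h => by rw [← h] at hCR; linarith
  -- The witness is the integer quotient `N / (m + 3)`; it is at least `1`, so rounding down costs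
  -- at most a factor `2`.
  obtain ⟨n, hn, hnN, hNn⟩ : ∃ n : ℕ, 0 < n ∧ (m + 3) * n ≤ N ∧ (N : ℝ) ≤ 2 * n * (m + 3) := by
    have hpos : 0 < m + 3 := by omega
    have h1 : 0 < N / (m + 3) := Nat.div_pos hN hpos
    refine ⟨N / (m + 3), h1, Nat.mul_div_le _ _, ?_⟩
    have h2 := Nat.lt_mul_div_succ N hpos
    have h3 : N ≤ 2 * (N / (m + 3)) * (m + 3) := by nlinarith
    exact_mod_cast h3
  have hn' : (0 : ℝ) < n := by exact_mod_cast hn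
  have hnN' : ((m : ℝ) + 3) * n ≤ N := by exact_mod_cast hnN
  -- Chosen so that the row-sum bound in `hsmall` becomes `D / (2 * C)`; the bound on `τ` makes `D ≤
  -- 1 / τ ≤ C`.
  set D : ℝ := 8 * m * (m + 3) ^ (m + 4) with hD
  have hD0 : 0 < D := by positivity
  have hDC : D ≤ C := by
    refine le_trans ?_ hCτ
    rw [le_one_div hD0 hτ]
    exact hτ0
  have hpow1 : (1 : ℝ) ≤ (m + 3) ^ (m + 4) := one_le_pow₀ (by linarith)
  have hτ1 : τ ≤ 1 := by
    refine hτ0.trans ((div_le_one hD0).2 ?_)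
    nlinarith
  have hdecay : (1 / (2 * n) / (R / N)) ^ 4 ≤ ((m : ℝ) + 3) ^ 4 / C ^ 2 := by
    have h1 : 1 / (2 * n) / (R / N) ≤ ((m : ℝ) + 3) / R := by
      rw [div_div_eq_mul_div, div_le_div_iff_of_pos_right hRpos, div_mul_eq_mul_div, one_mul,
        div_le_iff₀ (by positivity)]
      linarith
    calc _ ≤ (((m : ℝ) + 3) / R) ^ 4 := by gcongr
      _ = ((m : ℝ) + 3) ^ 4 / (R ^ 2) ^ 2 := by rw [div_pow]; ring
      _ ≤ _ := by gcongr
  set B : ℝ := min ((m + 3) ^ m * C) ((2 / τ) ^ (m - 1) * Real.exp (m + 3)) with hB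
  have hB0 : 0 < B := lt_min (by positivity) (by positivity)
  have hsmall : B * (4 * m * (1 / (2 * n) / (R / N)) ^ 4) ≤ 1 / 2 := by
    calc _ ≤ ((m + 3) ^ m * C) * (4 * m * (((m : ℝ) + 3) ^ 4 / C ^ 2)) := by
          gcongr
          exact min_le_left _ _
      _ = D / 2 / C := by rw [hD]; field_simp; ring
      _ ≤ 1 / 2 := by rw [div_le_iff₀ (by positivity)]; linarith
  have hδn : (1 / (2 * n) / (R / N)) ^ 4 ≤ 1 / 2 := by
    refine hdecay.trans ?_
    rw [div_le_iff₀ (by positivity)]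
    have h1 : ((m : ℝ) + 3) ^ 4 ≤ (m + 3) ^ (m + 4) :=
      pow_le_pow_right₀ (by linarith) (by omega)
    have h2 : 2 * ((m : ℝ) + 3) ^ 4 ≤ D := by rw [hD]; nlinarith
    nlinarith
  have hclose : ∀ t ∈ Ω, ∀ s ∈ cl t, n * dist t s ≤ 1 / 2 := by
    intro t ht s hs
    obtain ⟨h1, -, -, h2, -⟩ := hcl t ht
    obtain ⟨f, hf⟩ := h2.exists_lift hN2
    have h3 := (hf t h1 s hs).2
    calc n * dist t s ≤ n * (1 / N) := by gcongr
      _ ≤ 1 / 2 := by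
        rw [mul_one_div, div_le_div_iff₀ hN' (by norm_num)]
        nlinarith
  have hBprod : ∀ t ∈ Ω, ∏ s ∈ (cl t).filter (· ≠ t), 1 / (2 * n * dist t s) ≤ B := by
    intro t ht
    obtain ⟨h1, h2, h3, h4, -⟩ := hcl t ht
    exact le_min (prod_one_div_two_mul_dist_le_clusterComplexity hn hN0 hNn h2 ht h3)
      (prod_one_div_two_mul_dist_le hn hN2 hNn hτ hτ1 h1 h3 h4
        fun s hs s' hs' => hsepN.1 s (h2 hs) s' (h2 hs'))
  obtain ⟨v, hv1, hv2⟩ := sigmaMin_vandermonde_attained N hne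
  have key := norm_sq_vandermonde_lower_bound hn hnN cl (fun t ht => (hcl t ht).1)
    (fun t ht => (hcl t ht).2.2.1) hclose (by positivity : 0 < R / N)
    (fun t ht s hs hst => by
      rw [div_le_iff₀' hN']
      exact (hcl t ht).2.2.2.2 s hs hst) hB0.le hBprod hsmall hδn v
  rw [hv1, mul_one, ← hv2] at key
  have hBup : B ≤ (486 / τ) ^ (m - 1) := by
    refine (min_le_right _ _).trans ?_
    -- `243 = 3 ^ 5`, and `m + 3 ≤ 5 * (m - 1)` for `m ≥ 2`.
    have h1 : Real.exp (m + 3) ≤ (243 : ℝ) ^ (m - 1) := by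
      have h2 : Real.exp ((m + 3 : ℕ) : ℝ) ≤ 3 ^ (m + 3) := by
        rw [← Real.exp_one_pow]
        have := Real.exp_one_lt_three.le
        gcongr
      have h3 : (3 : ℝ) ^ (m + 3) ≤ 3 ^ (5 * (m - 1)) := pow_le_pow_right₀ (by norm_num) (by omega)
      rw [pow_mul] at h3
      norm_num at h3 h2
      linarith
    calc _ ≤ (2 / τ) ^ (m - 1) * (243 : ℝ) ^ (m - 1) := by gcongr
      _ = _ := by rw [← mul_pow]; congr 1; ring
  refine (pow_le_pow_iff_left₀ (by positivity) (sigmaMin_nonneg _) two_ne_zero).1 ?_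
  set σ := sigmaMin (vandermondeMatrix N Ω)
  rw [mul_pow, Real.sq_sqrt hN'.le]
  have h20 := thirty_two_mul_le_pow hm
  -- The factor `20 ^ (m - 1)` absorbs `32 * m * (m + 3)`; the constant `1 / 10000` works because
  -- `486 * 20 = 9720`.
  have hx : ((1 / 10000 * τ) ^ (m - 1) * ((486 / τ) ^ (m - 1)) * 20 ^ (m - 1)) ^ 2 ≤ 1 := by
    rw [← mul_pow, ← mul_pow, show 1 / 10000 * τ * (486 / τ) * 20 = 9720 / 10000 by field_simp; norm_num]
    exact pow_le_one₀ (by positivity) (pow_le_one₀ (by norm_num) (by norm_num))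
  set a := (1 / 10000 * τ) ^ (m - 1) with ha
  set b := (486 / τ) ^ (m - 1) with hb
  have hbpos : 0 < b := by positivity
  have hpos : 0 < 16 * (m : ℝ) * B ^ 2 := by positivity
  refine le_of_mul_le_mul_left ?_ hpos
  refine le_trans ?_ key
  calc 16 * (m : ℝ) * B ^ 2 * (N * a ^ 2) ≤ 16 * m * b ^ 2 * (2 * n * (m + 3) * a ^ 2) := by gcongr
    _ = n * ((32 * m * (m + 3)) * (a * b) ^ 2) := by ring
    _ ≤ n * ((20 ^ (m - 1)) ^ 2 * (a * b) ^ 2) := by gcongr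
    _ = n * (a * b * 20 ^ (m - 1)) ^ 2 := by ring
    _ ≤ n * 1 := by gcongr
    _ = n := mul_one _

/-! ### Families of nodes and the upper bound from equispaced nodes -/

theorem sigmaMin_sq_mul_le {m n : Type*} [Fintype m] [Fintype n] (A : Matrix m n ℂ) (v : m → ℂ) :
    sigmaMin A ^ 2 * ∑ i, ‖v i‖ ^ 2 ≤ ∑ k, ‖A.conjTranspose.mulVec v k‖ ^ 2 := by
  set w : EuclideanSpace ℂ m := WithLp.toLp 2 v with hw
  have h1 : ∑ i, ‖v i‖ ^ 2 = ‖w‖ ^ 2 := (EuclideanSpace.norm_sq_eq w).symm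
  have h2 : ∑ k, ‖A.conjTranspose.mulVec v k‖ ^ 2 =
      ‖(WithLp.toLp 2 (A.conjTranspose.mulVec v) : EuclideanSpace ℂ n)‖ ^ 2 := by
    rw [EuclideanSpace.norm_sq_eq]
  rw [h1, h2, ← mul_pow]
  refine pow_le_pow_left₀ (mul_nonneg (sigmaMin_nonneg A) (norm_nonneg _)) ?_ 2
  obtain h0 | h0 := (norm_nonneg w).eq_or_lt
  · rw [← h0, mul_zero]; exact norm_nonneg _
  rw [← le_div_iff₀ h0]
  refine csInf_le ⟨0, ?_⟩ ⟨((‖w‖⁻¹ : ℝ) : ℂ) • w, ?_, ?_⟩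
  · rintro _ ⟨u, -, rfl⟩; exact norm_nonneg _
  · rw [norm_smul, Complex.norm_real, norm_inv, norm_norm, inv_mul_cancel₀ h0.ne']
  · rw [WithLp.ofLp_smul, Matrix.mulVec_smul, WithLp.toLp_smul, norm_smul, Complex.norm_real,
      norm_inv, norm_norm, div_eq_inv_mul, hw]

theorem sigmaMin_submatrix_equiv {m m' n : Type*} [Fintype m] [Fintype m'] [Fintype n]
    (A : Matrix m n ℂ) (e : m' ≃ m) : sigmaMin (A.submatrix e id) = sigmaMin A := by
  unfold sigmaMin
  congr 1
  have hmul : ∀ v : m → ℂ, (A.submatrix e id).conjTranspose.mulVec (v ∘ e) =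
      A.conjTranspose.mulVec v := fun v => by
    ext k
    simp only [Matrix.mulVec, dotProduct, Matrix.conjTranspose_apply, Matrix.submatrix_apply,
      Function.comp_apply, id]
    exact e.sum_comp fun i => star (A i k) * v i
  ext r
  constructor
  · rintro ⟨v, hv, rfl⟩
    refine ⟨WithLp.toLp 2 (v.ofLp ∘ e.symm), ?_, ?_⟩
    · rw [← hv, EuclideanSpace.norm_eq, EuclideanSpace.norm_eq]
      exact congrArg _ (e.symm.sum_comp fun i => ‖v i‖ ^ 2)
    · rw [← hmul]
      simp [Function.comp_assoc]
  · rintro ⟨v, hv, rfl⟩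
    refine ⟨WithLp.toLp 2 (v.ofLp ∘ e), ?_, ?_⟩
    · rw [← hv, EuclideanSpace.norm_eq, EuclideanSpace.norm_eq]
      exact congrArg _ (e.sum_comp fun i => ‖v i‖ ^ 2)
    · rw [← hmul]

/-- The Vandermonde matrix of a family of nodes. -/
noncomputable def familyVandermonde (N : ℕ) {M : ℕ} (x : Fin M → UnitAddCircle) :
    Matrix (Fin M) (Fin N) ℂ :=
  Matrix.of fun i k => (AddCircle.toCircle (x i) : ℂ) ^ (k : ℕ)

theorem sigmaMin_familyVandermonde (N : ℕ) {M : ℕ} (x : Fin M ↪ UnitAddCircle) :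
    sigmaMin (vandermondeMatrix N (Finset.univ.map x)) = sigmaMin (familyVandermonde N x) := by
  let e : Fin M ≃ (Finset.univ.map x : Finset UnitAddCircle) :=
    Equiv.ofBijective (fun i => ⟨x i, Finset.mem_map_of_mem x (Finset.mem_univ i)⟩)
      ⟨fun i j h => x.injective (congrArg Subtype.val h), fun ⟨t, ht⟩ => by
        obtain ⟨i, -, rfl⟩ := Finset.mem_map.1 ht
        exact ⟨i, rfl⟩⟩
  rw [← sigmaMin_submatrix_equiv _ e]
  rfl

/-- A minimum over the fixed compact unit sphere of a jointly continuous function is continuous in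
the parameter, even where nodes collide. -/
theorem continuous_sigmaMin_familyVandermonde (N M : ℕ) :
    Continuous fun x : Fin M → UnitAddCircle => sigmaMin (familyVandermonde N x) := by
  have h := (isCompact_sphere (0 : EuclideanSpace ℂ (Fin M)) 1).continuous_sInf
    (f := fun (x : Fin M → UnitAddCircle) (v : EuclideanSpace ℂ (Fin M)) =>
      ‖(WithLp.toLp 2 ((familyVandermonde N x).conjTranspose.mulVec v.ofLp) :
        EuclideanSpace ℂ (Fin N))‖) (by
      have hc : Continuous fun x : Fin M → UnitAddCircle => familyVandermonde N x := by
        refine continuous_pi fun i => continuous_pi fun k => ?_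
        have := AddCircle.continuous_toCircle (T := 1)
        simp only [familyVandermonde, Matrix.of_apply]
        fun_prop
      change Continuous fun p : (Fin M → UnitAddCircle) × EuclideanSpace ℂ (Fin M) =>
        ‖(WithLp.toLp 2 ((familyVandermonde N p.1).conjTranspose.mulVec p.2.ofLp) :
          EuclideanSpace ℂ (Fin N))‖
      fun_prop)
  convert h using 2 with x
  unfold sigmaMin
  congr 1
  ext r
  simp [eq_comm]

/-- `m` equispaced nodes at normalized distance `τ`. -/
noncomputable def equispacedNodes (N m : ℕ) (τ : ℝ) (i : Fin m) : UnitAddCircle :=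
  ((i : ℝ) * (τ / N) : ℝ)

theorem mul_dist_equispacedNodes {N m : ℕ} {τ : ℝ} (hN : 2 ≤ N) (hτ : 0 < τ) (hmτ : m * τ ≤ 1)
    (i j : Fin m) : N * dist (equispacedNodes N m τ i) (equispacedNodes N m τ j) =
      |(i : ℝ) - j| * τ := by
  have hN' : (2 : ℝ) ≤ N := by exact_mod_cast hN
  have h1 : |((i : ℝ) * (τ / N) - j * (τ / N))| = |(i : ℝ) - j| * (τ / N) := by
    rw [← sub_mul, abs_mul, abs_of_pos (by positivity : 0 < τ / N)]
  have hij : |(i : ℝ) - j| ≤ m := by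
    have := i.2; have := j.2
    rw [abs_le]
    constructor
    · have : (j : ℝ) ≤ m := by exact_mod_cast j.2.le
      have : (0 : ℝ) ≤ i := Nat.cast_nonneg _
      linarith
    · have : (i : ℝ) ≤ m := by exact_mod_cast i.2.le
      have : (0 : ℝ) ≤ j := Nat.cast_nonneg _
      linarith
  have h2 : |(i : ℝ) - j| * (τ / N) ≤ 1 / 2 := by
    calc |(i : ℝ) - j| * (τ / N) ≤ m * (τ / N) := by gcongr
      _ = m * τ / N := by ring
      _ ≤ 1 / 2 := by gcongr
  rw [dist_eq_norm, equispacedNodes, equispacedNodes, ← AddCircle.coe_sub,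
    UnitAddCircle.norm_coe_of_abs_le (h1 ▸ h2), h1]
  field_simp

theorem equispacedNodes_injective {N m : ℕ} {τ : ℝ} (hN : 2 ≤ N) (hτ : 0 < τ) (hmτ : m * τ ≤ 1) :
    Function.Injective (equispacedNodes N m τ) := by
  intro i j hij
  have h := mul_dist_equispacedNodes hN hτ hmτ i j
  rw [hij, dist_self, mul_zero] at h
  have h1 := (mul_eq_zero.1 h.symm).resolve_right hτ.ne'
  rw [abs_eq_zero, sub_eq_zero] at h1
  exact Fin.ext (by exact_mod_cast h1)

theorem equispacedNodes_mem {N m : ℕ} {τ : ℝ} (hN : 2 ≤ N) (hm : 2 ≤ m) (hmN : m < N)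
    (hτ : 0 < τ) (hmτ : m * τ ≤ 1) :
    Finset.univ.map ⟨equispacedNodes N m τ, equispacedNodes_injective hN hτ hmτ⟩ ∈
      admissibleConfigurations N m τ := by
  have hN0 : 0 < N := by omega
  set Ω : Finset UnitAddCircle :=
    Finset.univ.map ⟨equispacedNodes N m τ, equispacedNodes_injective hN hτ hmτ⟩ with hΩ
  have hcard : Ω.card = m := by simp [hΩ]
  have hmem : ∀ t, t ∈ Ω ↔ ∃ i, equispacedNodes N m τ i = t := fun t => by simp [hΩ]
  -- With a single cluster the separation is an infimum over the empty set, hence infinite.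
  have hsep : ∀ r : ENNReal, r ≤ clusterSeparation N fun _ : Fin 1 => Ω := fun r => by
    simp only [clusterSeparation, le_iInf_iff]
    exact fun l l' h => absurd (Subsingleton.elim l l') h
  refine ⟨hcard ▸ hmN, (minimalSeparation_eq_iff hN0 hτ).2 ⟨?_, ?_⟩, 1, fun _ => Ω,
    ⟨?_, ?_, ?_, ?_⟩, ?_, hsep _⟩
  · intro t ht t' ht' hne
    obtain ⟨i, rfl⟩ := (hmem t).1 ht
    obtain ⟨j, rfl⟩ := (hmem t').1 ht'
    rw [mul_dist_equispacedNodes hN hτ hmτ]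
    refine le_mul_of_one_le_left hτ.le ?_
    have h1 : (i : ℤ) - j ≠ 0 := fun h => hne (congrArg _ (Fin.ext (by omega)))
    exact_mod_cast Int.one_le_abs h1
  · refine ⟨_, (hmem _).2 ⟨⟨0, by omega⟩, rfl⟩, _, (hmem _).2 ⟨⟨1, by omega⟩, rfl⟩, ?_, ?_⟩
    · exact fun h => by simpa using equispacedNodes_injective hN hτ hmτ h
    · rw [mul_dist_equispacedNodes hN hτ hmτ]; simp
  · exact fun _ => Finset.card_pos.1 (by omega)
  · exact Set.iUnion_const _
  · refine fun _ => ⟨0, fun t ht => ?_⟩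
    obtain ⟨i, rfl⟩ := (hmem t).1 ht
    have hN' : (0 : ℝ) < N := by exact_mod_cast hN0
    refine ⟨i * (τ / N), by positivity, ?_, rfl⟩
    have : (i : ℝ) ≤ m := by exact_mod_cast i.2.le
    rw [zero_add, ← mul_div_assoc]
    gcongr
    nlinarith
  · exact lt_of_lt_of_le (by norm_num : (1 : ENNReal) < 2) (hsep 2)
  · exact ⟨⟨0, hcard⟩, by rintro _ ⟨l, rfl⟩; exact hcard.le⟩

/-- Test vector: signed binomial coefficients. By the binomial theorem each entry of `A* c` is a
conjugate of `(1 - w) ^ (m - 1)` with `|1 - w| ≤ 2 * π * τ`, while the first entry of `c` alone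
gives norm at least `1`. -/
theorem sigmaMin_equispacedNodes_le {N m : ℕ} {τ : ℝ} (hm : 1 ≤ m) (hτ : 0 < τ) :
    sigmaMin (familyVandermonde N (equispacedNodes N m τ)) ≤
      √(N : ℝ) * (2 * Real.pi * τ) ^ (m - 1) := by
  obtain ⟨d, rfl⟩ := Nat.exists_eq_add_of_le' hm
  rw [Nat.add_sub_cancel]
  have hpi := Real.pi_pos
  refine (pow_le_pow_iff_left₀ (sigmaMin_nonneg _) (by positivity) two_ne_zero).1 ?_
  rw [mul_pow, Real.sq_sqrt N.cast_nonneg]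
  set c : Fin (d + 1) → ℂ := fun j => (-1) ^ (j : ℕ) * (d.choose j : ℂ) with hc
  have h1 := sigmaMin_sq_mul_le (familyVandermonde N (equispacedNodes N (d + 1) τ)) c
  have hc1 : 1 ≤ ∑ j, ‖c j‖ ^ 2 := by
    rw [Fin.sum_univ_succ]
    have : 0 ≤ ∑ j : Fin d, ‖c j.succ‖ ^ 2 := Finset.sum_nonneg fun _ _ => by positivity
    simp only [hc, Fin.val_zero, pow_zero, Nat.choose_zero_right, Nat.cast_one, mul_one, norm_one,
      one_pow]
    simp only [hc] at this
    linarith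
  have hk : ∀ k : Fin N,
      ‖(familyVandermonde N (equispacedNodes N (d + 1) τ)).conjTranspose.mulVec c k‖ ^ 2 ≤
        ((2 * Real.pi * τ) ^ d) ^ 2 := by
    intro k
    have hN' : (0 : ℝ) < N := by exact_mod_cast k.pos
    set w : ℂ := Complex.exp (Complex.I * ((2 * Real.pi * (τ / N * k) : ℝ) : ℂ)) with hw
    have hxw : ∀ j : Fin (d + 1),
        (AddCircle.toCircle (equispacedNodes N (d + 1) τ j) : ℂ) ^ (k : ℕ) = w ^ (j : ℕ) := by
      intro j
      rw [equispacedNodes, AddCircle.toCircle_apply_mk, Circle.coe_exp, ← Complex.exp_nat_mul, hw,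
        ← Complex.exp_nat_mul]
      congr 1
      push_cast
      ring
    have hsum : (familyVandermonde N (equispacedNodes N (d + 1) τ)).conjTranspose.mulVec c k =
        (starRingEnd ℂ) ((1 - w) ^ d) := by
      rw [sub_eq_neg_add, add_pow, map_sum, Finset.sum_range]
      simp only [Matrix.mulVec, dotProduct, Matrix.conjTranspose_apply, familyVandermonde,
        Matrix.of_apply, hxw, hc]
      refine Finset.sum_congr rfl fun j _ => ?_
      simp only [one_pow, mul_one, map_mul, map_pow, map_neg, map_natCast, RCLike.star_def]
      rw [neg_pow]
      ring
    rw [hsum, RCLike.norm_conj, norm_pow]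
    gcongr
    rw [norm_sub_rev]
    refine (Real.norm_exp_I_mul_ofReal_sub_one_le).trans ?_
    rw [Real.norm_of_nonneg (by positivity)]
    refine mul_le_mul_of_nonneg_left ?_ (by positivity)
    have : (k : ℝ) ≤ N := by exact_mod_cast k.2.le
    rw [div_mul_eq_mul_div, div_le_iff₀ hN']
    gcongr
  calc _ ≤ sigmaMin (familyVandermonde N (equispacedNodes N (d + 1) τ)) ^ 2 * ∑ j, ‖c j‖ ^ 2 :=
        le_mul_of_one_le_right (sq_nonneg _) hc1
    _ ≤ _ := h1
    _ ≤ ∑ k : Fin N, ((2 * Real.pi * τ) ^ d) ^ 2 := Finset.sum_le_sum fun k _ => hk k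
    _ = _ := by simp

/-! ### Compactness and existence of the minimum -/

theorem separationThreshold_continuous (m : ℕ) : Continuous (separationThreshold m) := by
  unfold separationThreshold
  fun_prop

/-- The product in the cluster complexity, regularized at normalized distances below `τ`. -/
noncomputable def regularizedComplexity (N : ℕ) (τ : ℝ) {M : ℕ} (x : Fin M → UnitAddCircle)
    (k : Fin M) : ℝ :=
  ∏ j, if j = k then 1 else max 1 (1 / max τ (N * dist (x k) (x j)))

theorem continuous_regularizedComplexity (N : ℕ) {τ : ℝ} (hτ : 0 < τ) {M : ℕ} (k : Fin M) :
    Continuous fun x : Fin M → UnitAddCircle => regularizedComplexity N τ x k := by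
  unfold regularizedComplexity
  refine continuous_finsetProd _ fun j _ => ?_
  split_ifs
  · fun_prop
  · refine continuous_const.max (continuous_const.div (by fun_prop) fun x => ?_)
    exact (lt_max_of_lt_left hτ).ne'

/-- The closed conditions on the positions of the nodes of an admissible configuration whose
clusters are indexed by the sets `φ l`. -/
def clusteredFamilies (N m : ℕ) (τ : ℝ) {M L : ℕ} (φ : Fin L → Finset (Fin M)) :
    Set (Fin M → UnitAddCircle) :=
  {x | (∀ i j, i ≠ j → τ ≤ N * dist (x i) (x j)) ∧
    (∃ i j, i ≠ j ∧ N * dist (x i) (x j) = τ) ∧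
    (∀ l, ∃ a : UnitAddCircle, ∀ i ∈ φ l,
      x i - a ∈ (fun r : ℝ => (r : UnitAddCircle)) '' Set.Icc 0 (1 / N)) ∧
    ∀ l l', l ≠ l' → ∀ i ∈ φ l, ∀ j ∈ φ l', ∀ k,
      separationThreshold m (regularizedComplexity N τ x k) ≤ N * dist (x i) (x j)}

theorem isClosed_clusteredFamilies (N m : ℕ) {τ : ℝ} (hτ : 0 < τ) {M L : ℕ}
    (φ : Fin L → Finset (Fin M)) : IsClosed (clusteredFamilies N m τ φ) := by
  have hdist : ∀ i j : Fin M, Continuous fun x : Fin M → UnitAddCircle => N * dist (x i) (x j) :=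
    fun i j => by fun_prop
  refine IsClosed.inter ?_ (IsClosed.inter ?_ (IsClosed.inter ?_ ?_))
  · change IsClosed {x : Fin M → UnitAddCircle | ∀ i j, i ≠ j → τ ≤ N * dist (x i) (x j)}
    simp only [Set.ofPred_forall]
    exact isClosed_iInter fun i => isClosed_iInter fun j => isClosed_iInter fun _ =>
      isClosed_le continuous_const (hdist i j)
  · have : {x : Fin M → UnitAddCircle | ∃ i j, i ≠ j ∧ N * dist (x i) (x j) = τ} =
        ⋃ (i) (j) (_ : i ≠ j), {x | N * dist (x i) (x j) = τ} := by
      ext x; simp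
    change IsClosed {x : Fin M → UnitAddCircle | ∃ i j, i ≠ j ∧ N * dist (x i) (x j) = τ}
    rw [this]
    exact isClosed_iUnion_of_finite fun i => isClosed_iUnion_of_finite fun j =>
      isClosed_iUnion_of_finite fun _ => isClosed_eq (hdist i j) continuous_const
  · have hK : IsClosed ((fun r : ℝ => (r : UnitAddCircle)) '' Set.Icc 0 (1 / (N : ℝ))) :=
      (isCompact_Icc.image (AddCircle.continuous_mk' 1)).isClosed
    change IsClosed {x : Fin M → UnitAddCircle | ∀ l, ∃ a : UnitAddCircle, ∀ i ∈ φ l,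
      x i - a ∈ (fun r : ℝ => (r : UnitAddCircle)) '' Set.Icc 0 (1 / (N : ℝ))}
    rw [Set.ofPred_forall]
    refine isClosed_iInter fun l => ?_
    -- The starting point `a` of the arc ranges over the compact circle, and projection along a
    -- compact factor is a closed map.
    have : {x : Fin M → UnitAddCircle | ∃ a : UnitAddCircle, ∀ i ∈ φ l,
        x i - a ∈ (fun r : ℝ => (r : UnitAddCircle)) '' Set.Icc 0 (1 / (N : ℝ))} =
        Prod.fst '' {p : (Fin M → UnitAddCircle) × UnitAddCircle | ∀ i ∈ φ l,
          p.1 i - p.2 ∈ (fun r : ℝ => (r : UnitAddCircle)) '' Set.Icc 0 (1 / (N : ℝ))} := by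
      ext x
      simp only [Set.mem_ofPred_eq, Set.mem_image (f := Prod.fst), Prod.exists, exists_and_right,
        exists_eq_right]
    rw [this]
    refine isClosedMap_fst_of_compactSpace _ ?_
    simp only [Set.ofPred_forall]
    refine isClosed_iInter fun i => isClosed_iInter fun _ => hK.preimage ?_
    fun_prop
  · change IsClosed {x : Fin M → UnitAddCircle | ∀ l l', l ≠ l' → ∀ i ∈ φ l, ∀ j ∈ φ l', ∀ k,
      separationThreshold m (regularizedComplexity N τ x k) ≤ N * dist (x i) (x j)}
    simp only [Set.ofPred_forall]
    exact isClosed_iInter fun l => isClosed_iInter fun l' => isClosed_iInter fun _ =>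
      isClosed_iInter fun i => isClosed_iInter fun _ => isClosed_iInter fun j =>
      isClosed_iInter fun _ => isClosed_iInter fun k => isClosed_le
        ((separationThreshold_continuous m).comp (continuous_regularizedComplexity N hτ k))
        (hdist i j)

/-- The combinatorial conditions on the index sets of the clusters. -/
def IsClusterIndexing (m : ℕ) {M L : ℕ} (φ : Fin L → Finset (Fin M)) : Prop :=
  (∀ l, (φ l).Nonempty) ∧ (∀ i, ∃ l, i ∈ φ l) ∧ IsGreatest (Set.range fun l => (φ l).card) m

theorem isCluster_map_iff {N M : ℕ} (x : Fin M ↪ UnitAddCircle) (s : Finset (Fin M)) :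
    IsCluster N (s.map x) ↔ ∃ a : UnitAddCircle, ∀ i ∈ s,
      x i - a ∈ (fun r : ℝ => (r : UnitAddCircle)) '' Set.Icc 0 (1 / N) := by
  constructor
  · rintro ⟨a, ha⟩
    refine ⟨a, fun i hi => ?_⟩
    obtain ⟨r, h1, h2, h3⟩ := ha (x i) (Finset.mem_map_of_mem x hi)
    exact ⟨r - a, ⟨by linarith, by linarith⟩, by simp only [AddCircle.coe_sub, h3]⟩
  · rintro ⟨a, ha⟩
    obtain ⟨b, rfl⟩ := QuotientAddGroup.mk_surjective a
    refine ⟨b, fun t ht => ?_⟩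
    obtain ⟨i, hi, rfl⟩ := Finset.mem_map.1 ht
    obtain ⟨r, hr, h⟩ := ha i hi
    refine ⟨b + r, by linarith [hr.1], by linarith [hr.2], ?_⟩
    rw [AddCircle.coe_add]
    exact (eq_sub_iff_add_eq'.1 h)

/-- The one non-closed condition, `ρ > 1`, is redundant: `τ < 1` and `𝒞 ≥ 1 / τ` push the threshold
above `1`. The regularization at `τ` changes nothing on `τ`-separated families, and the supremum in
the complexity becomes a condition for every index `k`. -/
theorem isClusteredConfiguration_map_iff {N m : ℕ} {τ : ℝ} (hN : 0 < N) (hm : 2 ≤ m) (hτ : 0 < τ)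
    (hτ1 : τ < 1) {M L : ℕ} (x : Fin M ↪ UnitAddCircle) (φ : Fin L → Finset (Fin M)) :
    (minimalSeparation N (Finset.univ.map x) = τ ∧
      IsClusteredConfiguration N (Finset.univ.map x) (fun l => (φ l).map x) ∧
      IsGreatest (Set.range fun l => ((φ l).map x).card) m ∧
      ENNReal.ofReal (separationThreshold m (clusterComplexity N (Finset.univ.map x))) ≤
        clusterSeparation N fun l => (φ l).map x) ↔
    IsClusterIndexing m φ ∧ (x : Fin M → UnitAddCircle) ∈ clusteredFamilies N m τ φ := by
  have hsep : minimalSeparation N (Finset.univ.map x) = τ ↔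
      (∀ i j, i ≠ j → τ ≤ N * dist (x i) (x j)) ∧
        ∃ i j, i ≠ j ∧ N * dist (x i) (x j) = τ := by
    rw [minimalSeparation_eq_iff hN hτ]
    simp
  have hU : (⋃ l, (((φ l).map x : Finset UnitAddCircle) : Set UnitAddCircle)) =
      ((Finset.univ.map x : Finset UnitAddCircle) : Set UnitAddCircle) ↔ ∀ i, ∃ l, i ∈ φ l := by
    rw [Set.ext_iff]
    constructor
    · intro h i
      have := (h (x i)).2 (by simp)
      simpa using this
    · intro h t
      simp only [Set.mem_iUnion, Finset.mem_coe, Finset.mem_map, Finset.mem_univ, true_and]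
      constructor
      · rintro ⟨l, i, -, rfl⟩; exact ⟨i, rfl⟩
      · rintro ⟨i, rfl⟩
        obtain ⟨l, hl⟩ := h i
        exact ⟨l, i, hl, rfl⟩
  have hthr : minimalSeparation N (Finset.univ.map x) = τ →
      1 < separationThreshold m (clusterComplexity N (Finset.univ.map x)) ∧
      ∀ r, separationThreshold m (clusterComplexity N (Finset.univ.map x)) ≤ r ↔
        ∀ k, separationThreshold m (regularizedComplexity N τ x k) ≤ r := by
    intro h
    have hpos : ∀ k, ∏ t' ∈ Finset.univ.map x, max 1 (1 / (N * dist (x k) t')) =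
        regularizedComplexity N τ x k := by
      intro k
      rw [Finset.prod_map, regularizedComplexity]
      refine Finset.prod_congr rfl fun j _ => ?_
      split_ifs with hjk
      · simp [hjk]
      · rw [max_eq_right ((hsep.1 h).1 k j (Ne.symm hjk))]
    have hC := one_div_le_clusterComplexity hN hτ h
    have hτ' : 1 < 1 / τ := by rwa [one_lt_div hτ]
    have hne : (Finset.univ.map x).Nonempty := by
      obtain ⟨i, -⟩ := (hsep.1 h).2
      exact ⟨x i, by simp⟩
    constructor
    · have h1 := le_sq_separationThreshold hm (by linarith :
        0 ≤ clusterComplexity N (Finset.univ.map x))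
      have h2 := separationThreshold_nonneg m (clusterComplexity N (Finset.univ.map x))
      nlinarith
    · intro r
      constructor
      · intro hr k
        refine le_trans (separationThreshold_mono m ?_) hr
        rw [← hpos]
        exact prod_le_clusterComplexity hN (by simp)
      · intro hr
        obtain ⟨t, ht, he⟩ := exists_clusterComplexity_eq_prod hN hne
        obtain ⟨k, -, rfl⟩ := Finset.mem_map.1 ht
        rw [he, hpos]
        exact hr k
  have hclu : ∀ l, IsCluster N ((φ l).map x) ↔ ∃ a : UnitAddCircle, ∀ i ∈ φ l,
      x i - a ∈ (fun r : ℝ => (r : UnitAddCircle)) '' Set.Icc 0 (1 / N) := fun l =>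
    isCluster_map_iff x (φ l)
  have hiff : minimalSeparation N (Finset.univ.map x) = τ →
      (ENNReal.ofReal (separationThreshold m (clusterComplexity N (Finset.univ.map x))) ≤
        (clusterSeparation N fun l => (φ l).map x) ↔
      ∀ l l', l ≠ l' → ∀ i ∈ φ l, ∀ j ∈ φ l', ∀ k,
        separationThreshold m (regularizedComplexity N τ x k) ≤ N * dist (x i) (x j)) := by
    intro h
    obtain ⟨h1, h2⟩ := hthr h
    rw [le_clusterSeparation_iff (zero_lt_one.trans h1)]
    simp only [Finset.forall_mem_map, h2]
  constructor
  · rintro ⟨h1, h2, h3, h4⟩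
    refine ⟨⟨fun l => Finset.map_nonempty.1 (h2.nonempty l), hU.1 h2.iUnion_eq, ?_⟩,
      (hsep.1 h1).1, (hsep.1 h1).2, fun l => (hclu l).1 (h2.isCluster l), (hiff h1).1 h4⟩
    simpa only [Finset.card_map] using h3
  · rintro ⟨⟨h1, h2, h3⟩, h4, h5, h6, h7⟩
    have h8 := hsep.2 ⟨h4, h5⟩
    have h9 := (hiff h8).2 h7
    refine ⟨h8, ⟨fun l => Finset.map_nonempty.2 (h1 l), hU.2 h2, fun l => (hclu l).2 (h6 l), ?_⟩,
      ?_, h9⟩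
    · refine lt_of_lt_of_le ?_ h9
      rw [← ENNReal.ofReal_one]
      exact (ENNReal.ofReal_lt_ofReal_iff (zero_lt_one.trans (hthr h8).1)).2 (hthr h8).1
    · simpa only [Finset.card_map] using h3

/-- Separated clusters are disjoint. The bound leaves finitely many cluster indexings in
`image_admissibleConfigurations`. -/
theorem IsClusteredConfiguration.le_card {N : ℕ} {Ω : Finset UnitAddCircle} {L : ℕ}
    {Λ : Fin L → Finset UnitAddCircle} (h : IsClusteredConfiguration N Ω Λ) : L ≤ Ω.card := by
  choose t ht using h.nonempty
  have hinj : Function.Injective t := by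
    intro l l' hl
    by_contra hne
    have h1 := (le_clusterSeparation_iff one_pos).1
      (by rw [ENNReal.ofReal_one]; exact h.one_lt_separation.le) l l' hne (t l) (ht l) (t l') (ht l')
    rw [hl, dist_self, mul_zero] at h1
    linarith
  have hmem : ∀ l, t l ∈ Ω := fun l => by
    rw [← Finset.mem_coe, ← h.iUnion_eq]
    exact Set.mem_iUnion.2 ⟨l, ht l⟩
  simpa using Finset.card_le_card_of_injOn (s := Finset.univ) t (fun l _ => hmem l) hinj.injOn

theorem image_admissibleConfigurations {N m : ℕ} {τ : ℝ} (hN : 0 < N) (hm : 2 ≤ m) (hτ : 0 < τ)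
    (hτ1 : τ < 1) :
    (fun Ω => sigmaMin (vandermondeMatrix N Ω)) '' admissibleConfigurations N m τ =
      ⋃ (M : Fin N) (L : Fin N) (φ : Fin L → Finset (Fin M)) (_ : IsClusterIndexing m φ),
        (fun x => sigmaMin (familyVandermonde N x)) '' clusteredFamilies N m τ φ := by
  classical
  ext σ
  simp only [Set.mem_iUnion]
  constructor
  · rintro ⟨Ω, ⟨h1, h2, L, Λ, h3, h4, h5⟩, rfl⟩
    let x : Fin Ω.card ↪ UnitAddCircle :=
      Ω.equivFin.symm.toEmbedding.trans (Function.Embedding.subtype _)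
    have hx : Finset.univ.map x = Ω := by
      ext t
      simp only [Finset.mem_map, Finset.mem_univ, true_and]
      constructor
      · rintro ⟨i, rfl⟩; exact (Ω.equivFin.symm i).2
      · intro ht; exact ⟨Ω.equivFin ⟨t, ht⟩, by simp [x]⟩
    have hΛΩ : ∀ l, Λ l ⊆ Ω := fun l t ht => by
      rw [← Finset.mem_coe, ← h3.iUnion_eq]
      exact Set.mem_iUnion.2 ⟨l, ht⟩
    let φ : Fin L → Finset (Fin Ω.card) := fun l => Finset.univ.filter fun i => x i ∈ Λ l
    have hφ : ∀ l, (φ l).map x = Λ l := by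
      intro l
      ext t
      simp only [φ, Finset.mem_map, Finset.mem_filter, Finset.mem_univ, true_and]
      constructor
      · rintro ⟨i, hi, rfl⟩; exact hi
      · intro ht
        have := hΛΩ l ht
        rw [← hx, Finset.mem_map] at this
        obtain ⟨i, -, rfl⟩ := this
        exact ⟨i, ht, rfl⟩
    have key := (isClusteredConfiguration_map_iff hN hm hτ hτ1 x φ).1
      (by simp only [hx, hφ]; exact ⟨h2, h3, h4, h5⟩)
    refine ⟨⟨Ω.card, h1⟩, ⟨L, h3.le_card.trans_lt h1⟩, φ, key.1, x, key.2, ?_⟩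
    simp only [← sigmaMin_familyVandermonde]
    rw [hx]
  · rintro ⟨M, L, φ, hφ, x, hx, rfl⟩
    have hinj : Function.Injective x := by
      intro i j hij
      by_contra hne
      have := hx.1 i j hne
      rw [hij, dist_self, mul_zero] at this
      linarith
    have key := (isClusteredConfiguration_map_iff hN hm hτ hτ1 ⟨x, hinj⟩ φ).2 ⟨hφ, hx⟩
    refine ⟨Finset.univ.map ⟨x, hinj⟩, ⟨by simp, key.1, L, _, key.2.1, key.2.2.1, key.2.2.2⟩, ?_⟩
    simp only [sigmaMin_familyVandermonde]
    rfl

theorem isCompact_image_admissibleConfigurations {N m : ℕ} {τ : ℝ} (hN : 0 < N) (hm : 2 ≤ m)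
    (hτ : 0 < τ) (hτ1 : τ < 1) :
    IsCompact ((fun Ω => sigmaMin (vandermondeMatrix N Ω)) '' admissibleConfigurations N m τ) := by
  rw [image_admissibleConfigurations hN hm hτ hτ1]
  exact isCompact_iUnion fun M => isCompact_iUnion fun L => isCompact_iUnion fun φ =>
    isCompact_iUnion fun _ => (isClosed_clusteredFamilies N m hτ φ).isCompact.image
      (continuous_sigmaMin_familyVandermonde N M)

theorem mainTheorem7 :
    ∃ c₁ c₂ : ℝ, 0 < c₁ ∧ c₁ ≤ c₂ ∧
      ∀ m : ℕ, 2 ≤ m →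
        ∃ (N₀ : ℕ) (τ₀ : ℝ), 0 < τ₀ ∧
          ∀ N : ℕ, N₀ ≤ N → ∀ τ : ℝ, 0 < τ → τ ≤ τ₀ →
            ∃ σ : ℝ,
              IsLeast ((fun Ω => sigmaMin (vandermondeMatrix N Ω)) ''
                admissibleConfigurations N m τ) σ ∧
              √(N : ℝ) * (c₁ * τ) ^ (m - 1) ≤ σ ∧ σ ≤ √(N : ℝ) * (c₂ * τ) ^ (m - 1) := by
  -- The constants are those of `sqrt_mul_pow_le_sigmaMin` and `sigmaMin_equispacedNodes_le`.
  refine ⟨1 / 10000, 2 * Real.pi, by norm_num, by linarith [Real.pi_gt_three], fun m hm => ?_⟩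
  refine ⟨m + 3, 1 / (8 * m * (m + 3) ^ (m + 4)), by positivity, fun N hN τ hτ hτ0 => ?_⟩
  have hm' : (2 : ℝ) ≤ m := by exact_mod_cast hm
  have hmτ : m * τ ≤ 1 / 8 := by
    have h1 : (1 : ℝ) ≤ (m + 3) ^ (m + 4) := one_le_pow₀ (by linarith)
    calc m * τ ≤ m * (1 / (8 * m * (m + 3) ^ (m + 4))) := by gcongr
      _ = 1 / 8 * (1 / (m + 3) ^ (m + 4)) := by field_simp
      _ ≤ 1 / 8 * 1 := by
        gcongr
        rwa [div_le_one (by positivity)]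
      _ = 1 / 8 := mul_one _
  have hmem := equispacedNodes_mem (N := N) (by omega) hm (by omega) hτ (by linarith)
  obtain ⟨σ, hσ⟩ := (isCompact_image_admissibleConfigurations (N := N) (by omega) hm hτ
    (by nlinarith)).exists_isLeast ⟨_, _, hmem, rfl⟩
  refine ⟨σ, hσ, ?_, ?_⟩
  · obtain ⟨Ω, hΩ, rfl⟩ := hσ.1
    exact sqrt_mul_pow_le_sigmaMin hm hN hτ hτ0 hΩ
  · refine (hσ.2 ⟨_, hmem, rfl⟩).trans ?_
    simp only [sigmaMin_familyVandermonde]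
    exact sigmaMin_equispacedNodes_le (by omega) hτ
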